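/- Let $K$ be a field and $S=K[x_1,\dots,x_n]$ with the standard grading. For a monomial ideal $I\subset S$ let $\mathcal G(I)$ be its minimal monomial generating set, let $\partial(I)$ be the ideal generated by all partial derivatives of the elements of $\mathcal G(I)$, and let $\partial^*(I)=(u/x_i : u\in\mathcal G(I),\ x_i\mid u)$. For a nonzero homogeneous ideal $J$ let $\operatorname{reg}J=\max\{j-i:\operatorname{Tor}^S_i(K,J)_j\neq 0\}$ be its Castelnuovo–Mumford regularity. For every $a\in\mathbb Z$ there exist an integer $n>0$ and a monomial ideal $I\subset K[x_1,\dots,x_n]$ with $\partial(I)=\partial^*(I)$ such that $$\operatorname{reg} I-\operatorname{reg}\partial(I)=a .$$ More explicitly: 1. If $a\le -1$ and $b=2-a$, the ideal $I=(x_1x_2,\ x_1x_3^b,\ x_2x_4^b)\subset K[x_1,\dots,x_4]$ has linear quotients (the elements of $\mathcal G(I)$ can be ordered as $u_1,\dots,u_m$ so that each colon ideal $(u_1,\dots,u_{k-1}):(u_k)$, $2\le k\le m$, is generated by variables), $\partial(I)=\partial^*(I)$ is a complete intersection (generated by a regular sequence), and $\operatorname{reg} I-\operatorname{reg}\partial(I)=a$.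 2. The ideal $I=(x_1x_2x_3,\ x_2x_3x_4,\ x_3x_4x_5,\ x_4x_5x_6)\subset K[x_1,\dots,x_6]$ satisfies $\partial(I)=\partial^*(I)$ and $\operatorname{reg} I-\operatorname{reg}\partial(I)=0$. 3. If $a\ge 1$ and $b,c\ge 2$ are integers with $b-c+1=a$, consider $I=(x^c,\ x^{c-1}y,\ \dots,\ xy^{c-1},\ y^b)\subset K[x,y]$. If $\operatorname{char}K=0$ or $\operatorname{char}K>b$, then $\partial(I)=\partial^*(I)$; and whenever $\partial(I)=\partial^*(I)$, one has $\operatorname{reg} I-\operatorname{reg}\partial(I)=a$. -/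

import Mathlib

open MvPolynomial

noncomputable section

namespace MonGrad

variable {n : ℕ} {K : Type*} [Field K]

/-! ### Monomial ideals -/

/-- A monomial ideal: an ideal generated by a set of monomials `x^a`. -/
def IsMonomialIdeal (I : Ideal (MvPolynomial (Fin n) K)) : Prop :=
  ∃ A : Set (Fin n →₀ ℕ), I = Ideal.span ((fun a => monomial a (1 : K)) '' A)

/-- The exponent vectors of the minimal monomial generating set of `I`: the monomials of `I` that
are minimal for divisibility among the monomials of `I`. -/
def minGens (I : Ideal (MvPolynomial (Fin n) K)) : Set (Fin n →₀ ℕ) :=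
  {a | Minimal (fun b => monomial b (1 : K) ∈ I) a}

/-- The gradient ideal of a monomial ideal `I`: the ideal generated by all the partial derivatives
of the minimal monomial generators of `I`. -/
def gradient (I : Ideal (MvPolynomial (Fin n) K)) : Ideal (MvPolynomial (Fin n) K) :=
  Ideal.span {p | ∃ a ∈ minGens I, ∃ i : Fin n, p = pderiv i (monomial a (1 : K))}

/-- The ideal generated by the monomials `u / x_i`, for `u` a minimal monomial generator of `I`
and `i` in the support of `u`. -/
def gradientStar (I : Ideal (MvPolynomial (Fin n) K)) : Ideal (MvPolynomial (Fin n) K) :=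
  Ideal.span {p | ∃ a ∈ minGens I, ∃ i ∈ a.support, p = monomial (a - Finsupp.single i 1) (1 : K)}

/-- The monomial ideal `I` has linear quotients: its minimal monomial generators can be ordered as
`u_1, …, u_m` so that every colon ideal `(u_1, …, u_{k-1}) : (u_k)`, `k = 2, …, m`, is generated by
variables. -/
def HasLinearQuotients (I : Ideal (MvPolynomial (Fin n) K)) : Prop :=
  ∃ (m : ℕ) (u : Fin m → (Fin n →₀ ℕ)), Function.Injective u ∧ Set.range u = minGens I ∧
    ∀ k : Fin m, 0 < (k : ℕ) → ∃ V : Set (Fin n),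
      (Ideal.span {p | ∃ l : Fin m, l < k ∧ p = monomial (u l) (1 : K)}).colon
        {monomial (u k) (1 : K)} = Ideal.span ((fun v => (X v : MvPolynomial (Fin n) K)) '' V)

/-- A complete intersection: an ideal generated by a regular sequence. -/
def IsCompleteIntersection (I : Ideal (MvPolynomial (Fin n) K)) : Prop :=
  ∃ rs : List (MvPolynomial (Fin n) K),
    RingTheory.Sequence.IsRegular (MvPolynomial (Fin n) K) rs ∧ I = Ideal.ofList rs

/-! ### Graded Betti numbers and Castelnuovo-Mumford regularity

`Tor_i(K, I)` is the `i`-th homology of `F ⊗ I`, for `F` a free resolution of the residue field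
`K = S / (x_1, …, x_n)`. We take for `F` its minimal graded free resolution, the Koszul complex on
`x_1, …, x_n`. In homological degree `i` it is free on basis elements `e_T` of degree `i`, for `T` a
subset of the variables with `i` elements, and
`d e_T = ∑ k ∈ T, (-1) ^ #{l ∈ T | l < k} x_k e_{T \ {k}}`.
An element `∑ T, e_T ⊗ f_T` of `F ⊗ I` is stored as the function `T ↦ f_T`. -/

/-- The Koszul differential. Its value at `T` collects the contributions of the basis elements
`e_{T ∪ {k}}`, for `k ∉ T`. -/
def koszulD (n : ℕ) (K : Type*) [Field K] :
    (Finset (Fin n) → MvPolynomial (Fin n) K) →ₗ[K]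
      (Finset (Fin n) → MvPolynomial (Fin n) K) where
  toFun f T := ∑ k ∈ Tᶜ, (-1) ^ (T.filter (· < k)).card * X k * f (insert k T)
  map_add' f g := by
    funext T
    simp [mul_add, Finset.sum_add_distrib]
  map_smul' c f := by
    funext T
    simp [Finset.smul_sum]

/-- The Koszul differential squares to zero. -/
theorem koszulD_koszulD (f : Finset (Fin n) → MvPolynomial (Fin n) K) :
    koszulD n K (koszulD n K f) = 0 := by
  funext T
  simp only [koszulD, LinearMap.coe_mk, AddHom.coe_mk, Finset.mul_sum, Pi.zero_apply]
  rw [Finset.sum_sigma']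
  refine Finset.sum_involution (fun x _ => ⟨x.2, x.1⟩) ?_ ?_ ?_ ?_
  · rintro ⟨k, l⟩ h
    simp only [Finset.mem_sigma, Finset.mem_compl, Finset.mem_insert, not_or] at h
    obtain ⟨hk, hlk, hl⟩ := h
    simp only [Finset.insert_comm l k T, Finset.filter_insert]
    rcases lt_or_gt_of_ne hlk with h | h
    · have h' : ¬ k < l := h.le.not_gt
      rw [if_neg h', if_pos h, Finset.card_insert_of_notMem (by simp [hl])]
      ring
    · have h' : ¬ l < k := h.le.not_gt
      rw [if_pos h, if_neg h', Finset.card_insert_of_notMem (by simp [hk])]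
      ring
  · rintro ⟨k, l⟩ h _ he
    simp only [Finset.mem_sigma, Finset.mem_compl, Finset.mem_insert, not_or] at h
    simp only [Sigma.mk.injEq, heq_eq_eq] at he
    exact h.2.1 he.1
  · rintro ⟨k, l⟩ h
    simp only [Finset.mem_sigma, Finset.mem_compl, Finset.mem_insert, not_or] at h ⊢
    exact ⟨h.2.2, fun e => h.2.1 e.symm, h.1⟩
  · rintro ⟨k, l⟩ _
    rfl

/-- The degree `j` part of `F_i ⊗ I`: the coefficient of `e_T` is zero unless `T` has `i` elements,
and then it is an element of `I` that is homogeneous of degree `j - i`. -/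
def koszulChains (I : Ideal (MvPolynomial (Fin n) K)) (i j : ℕ) :
    Submodule K (Finset (Fin n) → MvPolynomial (Fin n) K) :=
  Submodule.pi Set.univ fun T =>
    if T.card = i ∧ i ≤ j then I.restrictScalars K ⊓ homogeneousSubmodule (Fin n) K (j - i) else ⊥

/-- The cycles of `F_i ⊗ I` of degree `j`. -/
def koszulCycles (I : Ideal (MvPolynomial (Fin n) K)) (i j : ℕ) :
    Submodule K (Finset (Fin n) → MvPolynomial (Fin n) K) :=
  koszulChains I i j ⊓ LinearMap.ker (koszulD n K)

/-- The boundaries of `F_i ⊗ I` of degree `j`. -/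
def koszulBoundaries (I : Ideal (MvPolynomial (Fin n) K)) (i j : ℕ) :
    Submodule K (Finset (Fin n) → MvPolynomial (Fin n) K) :=
  (koszulChains I (i + 1) j).map (koszulD n K)

/-- Boundaries are cycles. -/
theorem koszulBoundaries_le (I : Ideal (MvPolynomial (Fin n) K)) (i j : ℕ) :
    koszulBoundaries I i j ≤ koszulCycles I i j := by
  rintro _ ⟨f, hf, rfl⟩
  refine ⟨?_, koszulD_koszulD f⟩
  simp only [koszulChains, SetLike.mem_coe, Submodule.mem_pi, Set.mem_univ, true_implies] at hf ⊢
  intro T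
  refine Submodule.sum_mem _ fun k hk => ?_
  have hT : (insert k T).card = T.card + 1 :=
    Finset.card_insert_of_notMem (by simpa using hk)
  have h := hf (insert k T)
  rw [hT] at h
  split_ifs at h with h1
  · rw [if_pos ⟨by omega, by omega⟩]
    obtain ⟨hI, hd⟩ := h
    refine ⟨I.mul_mem_left _ hI, ?_⟩
    have h2 : ((-1) ^ (T.filter (· < k)).card * X k : MvPolynomial (Fin n) K).IsHomogeneous
        (0 + 1) := by
      refine MvPolynomial.IsHomogeneous.mul ?_ (isHomogeneous_X K k)
      simpa using isHomogeneous_C (Fin n) ((-1 : K) ^ (T.filter (· < k)).card)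
    have h3 := h2.mul ((mem_homogeneousSubmodule _ _).1 hd)
    have e : 0 + 1 + (j - (i + 1)) = j - i := by omega
    rw [e] at h3
    exact (mem_homogeneousSubmodule _ _).2 h3
  · rw [(Submodule.mem_bot K).1 h, mul_zero]
    exact Submodule.zero_mem _

/-- `Tor_i(K, I)_j`, the degree `j` part of the homology of `F ⊗ I` at `F_i ⊗ I`. -/
abbrev GradedTor (I : Ideal (MvPolynomial (Fin n) K)) (i j : ℕ) : Type _ :=
  koszulCycles I i j ⧸ (koszulBoundaries I i j).submoduleOf (koszulCycles I i j)

/-- The graded Betti number `β_{i,j}(I) = dim_K Tor_i(K, I)_j`. -/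
def betti (I : Ideal (MvPolynomial (Fin n) K)) (i j : ℕ) : ℕ :=
  Module.finrank K (GradedTor I i j)

/-- `reg I = r`, that is, `r` is the maximum of the `j - i` with `β_{i,j}(I) ≠ 0`. In particular
the maximum exists; this never holds for `I = 0`. -/
def HasRegularity (I : Ideal (MvPolynomial (Fin n) K)) (r : ℤ) : Prop :=
  IsGreatest {d : ℤ | ∃ i j : ℕ, betti I i j ≠ 0 ∧ d = (j : ℤ) - (i : ℤ)} r

/-- The regularities of `I` and of its gradient ideal exist, and their difference is `a`. -/
def RegDiffEq (I : Ideal (MvPolynomial (Fin n) K)) (a : ℤ) : Prop :=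
  ∃ r s : ℤ, HasRegularity I r ∧ HasRegularity (gradient I) s ∧ r - s = a

/-! ### The explicit ideals (the variables `x_1, x_2, …` are `X 0, X 1, …`) -/

/-- `(x_1 x_2, x_1 x_3^b, x_2 x_4^b)` in four variables. -/
def negIdeal (K : Type*) [Field K] (b : ℕ) : Ideal (MvPolynomial (Fin 4) K) :=
  Ideal.span {X 0 * X 1, X 0 * X 2 ^ b, X 1 * X 3 ^ b}

/-- `(x_1 x_2 x_3, x_2 x_3 x_4, x_3 x_4 x_5, x_4 x_5 x_6)` in six variables. -/
def pathIdeal (K : Type*) [Field K] : Ideal (MvPolynomial (Fin 6) K) :=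
  Ideal.span {X 0 * X 1 * X 2, X 1 * X 2 * X 3, X 2 * X 3 * X 4, X 3 * X 4 * X 5}

/-- `(x^c, x^(c-1) y, …, x y^(c-1), y^b)` in the two variables `x = X 0` and `y = X 1`. -/
def planeIdeal (K : Type*) [Field K] (b c : ℕ) : Ideal (MvPolynomial (Fin 2) K) :=
  Ideal.span ({p | ∃ i < c, p = X 0 ^ (c - i) * X 1 ^ i} ∪ {X 1 ^ b})

end MonGrad

end

open MvPolynomial

noncomputable section

namespace MonGrad

variable {n : ℕ} {K : Type*} [Field K]

/-! ### Monomial ideals given by exponent vectors -/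

/-! Each regularity is pinned between an upper bound and an explicit nonzero Tor class. Upper bounds
come from adding generators one at a time: for a monomial `u` of degree `d`, the exact sequence `0 →
(J : u)(-d) → J ⊕ S(-d) → J + (u) → 0` gives `reg (J + (u)) ≤ max (reg J, reg (J : u) + d - 1, d)`.
`RegLE.insert_generator` carries this out on Koszul cycles, using acyclicity of the Koszul complex
over `S` (`regLE_top`). Since colons of monomial ideals are read off exponents, each application
reduces to combinatorics. Lower bounds come from a minimal generator (`Tor_0`), a socle monomial of
`S / I` (`Tor_{n-1}`), or, for the gradient of the path ideal, a syzygy between two disjoint edges.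
For `negIdeal` the regularity is `b + 1`, while the gradient `(x_1, x_2, x_3^b, x_4^b)` has
regularity `2b - 1`, with difference `2 - b`. For `pathIdeal` both regularities are `3`. For
`planeIdeal` the regularity is `b` and `gradientStar` is `(x, y)^(c-1)`, of regularity `c - 1`. With
`c = 2` the equality of the two gradients holds in every characteristic, so all positive differences
occur over every field. -/

/-- The monomial with exponent vector `a`. -/
abbrev mon (K : Type*) [Field K] (a : Fin n → ℕ) : MvPolynomial (Fin n) K :=
  monomial (Finsupp.equivFunOnFinite.symm a) 1

/-- The monomial ideal generated by the monomials with exponent vectors in `A`. -/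
def monIdeal (K : Type*) [Field K] (A : Set (Fin n → ℕ)) : Ideal (MvPolynomial (Fin n) K) :=
  Ideal.span (mon K '' A)

theorem mon_eq_prod (a : Fin n → ℕ) : mon K a = ∏ i, X i ^ a i := by
  rw [mon, monomial_eq, Finsupp.prod_fintype _ _ (by simp)]
  simp

theorem mem_monIdeal {A : Set (Fin n → ℕ)} {f : MvPolynomial (Fin n) K} :
    f ∈ monIdeal K A ↔ ∀ e ∈ f.support, ∃ a ∈ A, a ≤ ⇑e := by
  have h : monIdeal K A = Ideal.span ((fun s => monomial s (1 : K)) ''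
      (Finsupp.equivFunOnFinite.symm '' A)) := by
    rw [monIdeal, Set.image_image]
  rw [h, mem_ideal_span_monomial_image]
  simp only [Set.exists_mem_image]
  rfl

theorem monomial_mem_monIdeal {A : Set (Fin n → ℕ)} {e : Fin n →₀ ℕ} {c : K} (hc : c ≠ 0) :
    monomial e c ∈ monIdeal K A ↔ ∃ a ∈ A, a ≤ ⇑e := by
  classical
  rw [mem_monIdeal, support_monomial, if_neg hc]
  simp

theorem isMonomialIdeal_monIdeal (A : Set (Fin n → ℕ)) : IsMonomialIdeal (monIdeal K A) :=
  ⟨Finsupp.equivFunOnFinite.symm '' A, by rw [monIdeal, Set.image_image]⟩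

theorem monIdeal_mono_of {A B : Set (Fin n → ℕ)} (h : ∀ a ∈ A, ∃ b ∈ B, b ≤ a) :
    monIdeal K A ≤ monIdeal K B := by
  rw [monIdeal, Ideal.span_le]
  rintro _ ⟨a, ha, rfl⟩
  exact (monomial_mem_monIdeal one_ne_zero).2 (h a ha)

theorem mon_mem_monIdeal {A : Set (Fin n → ℕ)} {a : Fin n → ℕ} (ha : a ∈ A) :
    mon K a ∈ monIdeal K A :=
  Ideal.subset_span ⟨a, ha, rfl⟩

@[simp]
theorem monIdeal_empty : monIdeal K (∅ : Set (Fin n → ℕ)) = ⊥ := by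
  simp [monIdeal]

/-- The two hypotheses say that `B` generates the colon ideal: with truncated subtraction, `x - a`
is the exponent vector of `x / gcd(x, a)`, and these quotients generate the colon of a monomial
ideal. -/
theorem mon_mul_mem_monIdeal_iff {A B : Set (Fin n → ℕ)} {a : Fin n → ℕ}
    (h1 : ∀ x ∈ A, ∃ b ∈ B, b ≤ x - a) (h2 : ∀ b ∈ B, ∃ x ∈ A, x ≤ b + a)
    {f : MvPolynomial (Fin n) K} : mon K a * f ∈ monIdeal K A ↔ f ∈ monIdeal K B := by
  constructor
  · intro h
    rw [mem_monIdeal] at h ⊢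
    intro e he
    obtain ⟨x, hx, hxe⟩ := h (Finsupp.equivFunOnFinite.symm a + e) (by
      rw [mem_support_iff] at he ⊢
      rwa [coeff_monomial_mul, one_mul])
    obtain ⟨b, hb, hbx⟩ := h1 x hx
    refine ⟨b, hb, hbx.trans fun i => ?_⟩
    have := hxe i
    simp only [Finsupp.coe_add, Pi.add_apply, Finsupp.coe_equivFunOnFinite_symm] at this
    simp only [Pi.sub_apply]
    omega
  · intro h
    have h3 : monIdeal K B ≤ (monIdeal K A).colon {mon K a} := by
      rw [monIdeal, Ideal.span_le]
      rintro _ ⟨b, hb, rfl⟩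
      rw [SetLike.mem_coe, Submodule.mem_colon_singleton, smul_eq_mul, monomial_mul, mul_one,
        monomial_mem_monIdeal one_ne_zero]
      exact h2 b hb
    have := h3 h
    rwa [Submodule.mem_colon_singleton, smul_eq_mul, mul_comm] at this

theorem colon_monIdeal {A B : Set (Fin n → ℕ)} {a : Fin n → ℕ}
    (h1 : ∀ x ∈ A, ∃ b ∈ B, b ≤ x - a) (h2 : ∀ b ∈ B, ∃ x ∈ A, x ≤ b + a) :
    (monIdeal K A).colon {mon K a} = monIdeal K B := by
  ext f
  rw [Submodule.mem_colon_singleton, smul_eq_mul, mul_comm, mon_mul_mem_monIdeal_iff h1 h2]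

theorem isHomogeneous_mon (a : Fin n → ℕ) : (mon K a).IsHomogeneous (∑ i, a i) :=
  isHomogeneous_monomial _ (by rw [Finsupp.degree_eq_sum]; rfl)

/-- Every monomial of `f` is divisible by `a` or by an element of `A`, so the terms of `f` can be
sorted into two groups, preserving degrees. -/
theorem exists_add_mon_mul {A : Set (Fin n → ℕ)} {a : Fin n → ℕ} {m d : ℕ}
    (hd : ∑ i, a i = d) {f : MvPolynomial (Fin n) K}
    (hf : f ∈ monIdeal K (insert a A)) (hm : f.IsHomogeneous m) :
    ∃ p q : MvPolynomial (Fin n) K, p ∈ monIdeal K A ∧ p.IsHomogeneous m ∧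
      q.IsHomogeneous (m - d) ∧ f = p + mon K a * q := by
  rw [mem_monIdeal] at hf
  have key : f ∈ ((monIdeal K A).restrictScalars K ⊓ homogeneousSubmodule (Fin n) K m) ⊔
      (homogeneousSubmodule (Fin n) K (m - d)).map (LinearMap.mulLeft K (mon K a)) := by
    rw [f.as_sum]
    refine Submodule.sum_mem _ fun e he => ?_
    have hde : e.degree = m := by
      by_contra h
      exact mem_support_iff.1 he (hm.coeff_eq_zero h)
    obtain ⟨x, hx, hxe⟩ := hf e he
    rcases hx with rfl | hx
    · have h1 : Finsupp.equivFunOnFinite.symm x + (e - Finsupp.equivFunOnFinite.symm x) = e :=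
        add_tsub_cancel_of_le hxe
      refine Submodule.mem_sup_right
        ⟨monomial (e - Finsupp.equivFunOnFinite.symm x) (coeff e f), ?_, ?_⟩
      · refine isHomogeneous_monomial _ ?_
        have h2 := congrArg Finsupp.degree h1
        rw [map_add, hde, Finsupp.degree_eq_sum] at h2
        simp only [Finsupp.coe_equivFunOnFinite_symm] at h2
        omega
      · rw [LinearMap.mulLeft_apply, monomial_mul, one_mul, h1]
    · refine Submodule.mem_sup_left ⟨?_, isHomogeneous_monomial _ hde⟩
      exact (monomial_mem_monIdeal (mem_support_iff.1 he)).2 ⟨x, hx, hxe⟩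
  obtain ⟨p, hp, _, ⟨q, hq, rfl⟩, h⟩ := Submodule.mem_sup.1 key
  exact ⟨p, q, hp.1, hp.2, hq, h.symm⟩

/-! ### Koszul chains -/

theorem mem_koszulChains {I : Ideal (MvPolynomial (Fin n) K)} {i j : ℕ} (hij : i ≤ j)
    {f : Finset (Fin n) → MvPolynomial (Fin n) K} :
    f ∈ koszulChains I i j ↔
      ∀ T, f T ∈ I ∧ (f T).IsHomogeneous (j - i) ∧ (T.card ≠ i → f T = 0) := by
  simp only [koszulChains, Submodule.mem_pi, Set.mem_univ, true_implies]
  refine forall_congr' fun T => ?_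
  by_cases hT : T.card = i
  · rw [if_pos ⟨hT, hij⟩]
    simp [hT]
  · rw [if_neg (by tauto), Submodule.mem_bot]
    constructor
    · intro h
      rw [h]
      exact ⟨I.zero_mem, isHomogeneous_zero _ _ _, fun _ => rfl⟩
    · exact fun h => h.2.2 hT

theorem eq_zero_of_mem_koszulChains {I : Ideal (MvPolynomial (Fin n) K)} {i j : ℕ}
    {f : Finset (Fin n) → MvPolynomial (Fin n) K} (hf : f ∈ koszulChains I i j)
    {T : Finset (Fin n)} (hT : T.card ≠ i) : f T = 0 := by
  simp only [koszulChains, Submodule.mem_pi, Set.mem_univ, true_implies] at hf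
  have := hf T
  rwa [if_neg (by tauto), Submodule.mem_bot] at this

theorem mem_of_mem_koszulChains {I : Ideal (MvPolynomial (Fin n) K)} {i j : ℕ}
    {f : Finset (Fin n) → MvPolynomial (Fin n) K} (hf : f ∈ koszulChains I i j)
    (T : Finset (Fin n)) : f T ∈ I := by
  simp only [koszulChains, Submodule.mem_pi, Set.mem_univ, true_implies] at hf
  have := hf T
  split_ifs at this with h
  · exact this.1
  · rw [(Submodule.mem_bot K).1 this]
    exact I.zero_mem

theorem koszulD_apply (f : Finset (Fin n) → MvPolynomial (Fin n) K) (T : Finset (Fin n)) :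
    koszulD n K f T = ∑ k ∈ Tᶜ, (-1) ^ (T.filter (· < k)).card * X k * f (insert k T) := rfl

theorem koszulD_mul (u : MvPolynomial (Fin n) K)
    (f : Finset (Fin n) → MvPolynomial (Fin n) K) :
    koszulD n K (fun T => u * f T) = fun T => u * koszulD n K f T := by
  funext T
  simp only [koszulD_apply, Finset.mul_sum]
  exact Finset.sum_congr rfl fun k _ => by ring

theorem koszulD_mem {I : Ideal (MvPolynomial (Fin n) K)}
    {f : Finset (Fin n) → MvPolynomial (Fin n) K} (hf : ∀ T, f T ∈ I) (T : Finset (Fin n)) :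
    koszulD n K f T ∈ I :=
  Submodule.sum_mem _ fun _ _ => I.mul_mem_left _ (hf _)

theorem koszulD_eq_zero_of_mem_koszulChains_zero {I : Ideal (MvPolynomial (Fin n) K)} {j : ℕ}
    {f : Finset (Fin n) → MvPolynomial (Fin n) K} (hf : f ∈ koszulChains I 0 j) :
    koszulD n K f = 0 := by
  funext T
  refine Finset.sum_eq_zero fun k _ => ?_
  rw [eq_zero_of_mem_koszulChains hf (by simp), mul_zero]

/-- The vanishing of `Tor_i(K, I)_j` for all `j - i > r`. -/
def RegLE (I : Ideal (MvPolynomial (Fin n) K)) (r : ℕ) : Prop :=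
  ∀ i j : ℕ, i + r < j → koszulCycles I i j ≤ koszulBoundaries I i j

theorem RegLE.mono {I : Ideal (MvPolynomial (Fin n) K)} {r s : ℕ} (h : RegLE I r) (hrs : r ≤ s) :
    RegLE I s := fun i j hij => h i j (by omega)

theorem regLE_bot (r : ℕ) : RegLE (⊥ : Ideal (MvPolynomial (Fin n) K)) r := by
  intro i j _ z hz
  have : z = 0 := funext fun T => by simpa using mem_of_mem_koszulChains hz.1 T
  rw [this]
  exact Submodule.zero_mem _

/-! ### Acyclicity of the Koszul complex -/

/-- The contraction of the Koszul complex along the variable `x_k`. -/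
def contract (k : Fin n) (f : Finset (Fin n) → MvPolynomial (Fin n) K) (T : Finset (Fin n)) :
    MvPolynomial (Fin n) K :=
  if k ∈ T then (-1) ^ (T.filter (· < k)).card *
    (f (T.erase k)).divMonomial (Finsupp.single k 1) else 0

/-- The part of a chain where `x_k` occurs neither in the basis elements nor in the
coefficients. -/
def freePart (k : Fin n) (f : Finset (Fin n) → MvPolynomial (Fin n) K) (T : Finset (Fin n)) :
    MvPolynomial (Fin n) K :=
  if k ∈ T then 0 else (f T).modMonomial (Finsupp.single k 1)

theorem isHomogeneous_divMonomial_single {f : MvPolynomial (Fin n) K} {m : ℕ} (k : Fin n)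
    (hf : f.IsHomogeneous m) : (f.divMonomial (Finsupp.single k 1)).IsHomogeneous (m - 1) := by
  intro e he
  rw [coeff_divMonomial] at he
  have h : (Finsupp.single k 1 + e).degree = m := by
    by_contra h
    exact he (hf.coeff_eq_zero h)
  rw [map_add, Finsupp.degree_single] at h
  have h2 : Finsupp.weight 1 e = e.degree := (DFunLike.congr_fun Finsupp.degree_eq_weight_one e).symm
  omega

theorem X_mul_divMonomial_of_ne {k l : Fin n} (hkl : l ≠ k) (f : MvPolynomial (Fin n) K) :
    (X l * f).divMonomial (Finsupp.single k 1) = X l * f.divMonomial (Finsupp.single k 1) := by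
  classical
  ext e
  rw [coeff_divMonomial, coeff_X_mul', coeff_X_mul', coeff_divMonomial]
  have h : l ∈ (Finsupp.single k 1 + e).support ↔ l ∈ e.support := by
    simp [hkl.symm]
  simp only [h]
  split_ifs with h1
  · congr 1
    have : Finsupp.single l 1 ≤ e := by
      rw [Finsupp.single_le_iff]
      exact Nat.one_le_iff_ne_zero.2 (Finsupp.mem_support_iff.1 h1)
    rw [add_tsub_assoc_of_le this]
  · rfl

/-- Division by a variable as a linear map. -/
def divX (K : Type*) [Field K] (k : Fin n) : MvPolynomial (Fin n) K →ₗ[K] MvPolynomial (Fin n) K where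
  toFun f := f.divMonomial (Finsupp.single k 1)
  map_add' f g := add_divMonomial f g _
  map_smul' c f := by
    ext e
    simp

theorem divX_neg_one_pow_mul (k : Fin n) (m : ℕ) (f : MvPolynomial (Fin n) K) :
    divX K k ((-1) ^ m * f) = (-1) ^ m * divX K k f := by
  rcases neg_one_pow_eq_or (MvPolynomial (Fin n) K) m with h | h <;> rw [h] <;> simp

/-- `contract k` divides by `x_k` and multiplies by `e_k`. It is a homotopy from the identity to
`freePart k`; on cycles only one of the two homotopy terms survives. -/
theorem koszulD_contract {k : Fin n} {f : Finset (Fin n) → MvPolynomial (Fin n) K}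
    (hf : koszulD n K f = 0) : koszulD n K (contract k f) = f - freePart k f := by
  funext T
  rw [Pi.sub_apply, koszulD_apply]
  by_cases hk : k ∈ T
  · have h0 := congrArg (divX K k) (congrFun hf (T.erase k))
    have hsub : (T.erase k)ᶜ = insert k Tᶜ := by
      ext x
      simp only [Finset.mem_compl, Finset.mem_erase, Finset.mem_insert]
      tauto
    rw [Pi.zero_apply, map_zero, koszulD_apply, map_sum, hsub,
      Finset.sum_insert (by simpa using hk), Finset.insert_erase hk, mul_assoc,
      divX_neg_one_pow_mul] at h0
    have hX : divX K k (X k * f T) = f T := X_mul_divMonomial k (f T)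
    have hkk : ((T.erase k).filter (· < k)) = T.filter (· < k) := by
      ext x
      simp only [Finset.mem_filter, Finset.mem_erase]
      constructor
      · tauto
      · exact fun h => ⟨⟨h.2.ne, h.1⟩, h.2⟩
    rw [hX, hkk] at h0
    set s : MvPolynomial (Fin n) K := (-1) ^ (T.filter (· < k)).card with hs
    have hss : s * s = 1 := by rw [hs, ← mul_pow]; simp
    have hfree : freePart k f T = 0 := if_pos hk
    rw [hfree, sub_zero]
    have : ∑ l ∈ Tᶜ, (-1) ^ (T.filter (· < l)).card * X l * contract k f (insert l T) =
        -(s * ∑ l ∈ Tᶜ, divX K k ((-1) ^ ((T.erase k).filter (· < l)).card * X l *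
          f (insert l (T.erase k)))) := by
      rw [Finset.mul_sum, ← Finset.sum_neg_distrib]
      refine Finset.sum_congr rfl fun l hl => ?_
      have hlT : l ∉ T := by simpa using hl
      have hlk : l ≠ k := fun h => hlT (h ▸ hk)
      rw [contract, if_pos (Finset.mem_insert_of_mem hk), Finset.erase_insert_of_ne hlk,
        mul_assoc _ (X l), mul_assoc _ (X l), divX_neg_one_pow_mul]
      change _ * (_ * (_ * divX K k _)) = _
      have h1 : divX K k (X l * f (insert l (T.erase k))) =
        X l * divX K k (f (insert l (T.erase k))) := X_mul_divMonomial_of_ne hlk _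
      rw [h1, hs]
      rcases lt_or_gt_of_ne hlk with h | h
      · have e1 : (insert l T).filter (· < k) = insert l (T.filter (· < k)) := by
          rw [Finset.filter_insert, if_pos h]
        have e2 : (T.erase k).filter (· < l) = T.filter (· < l) := by
          rw [Finset.filter_erase, Finset.erase_eq_of_notMem]
          simp [h.le]
        rw [e1, e2, Finset.card_insert_of_notMem (by simp [hlT])]
        ring
      · have e1 : (insert l T).filter (· < k) = T.filter (· < k) := by
          rw [Finset.filter_insert, if_neg h.le.not_gt]
        have e2 : T.filter (· < l) = insert k ((T.erase k).filter (· < l)) := by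
          rw [← Finset.insert_erase hk, Finset.filter_insert, if_pos h, Finset.insert_erase hk]
        rw [e1, e2, Finset.card_insert_of_notMem (by simp)]
        ring
    rw [this]
    linear_combination (-s) * h0 + f T * hss
  -- For `k ∉ T` only `l = k` contributes, and it gives the part of `f T` divisible by `x_k`.
  · rw [Finset.sum_eq_single_of_mem k (by simpa using hk)]
    · rw [contract, if_pos (Finset.mem_insert_self _ _), Finset.erase_insert hk, freePart,
        if_neg hk, Finset.filter_insert, if_neg (lt_irrefl k)]
      have h2 := divMonomial_add_modMonomial_single (f T) k
      have hss : ((-1) ^ (T.filter (· < k)).card * (-1) ^ (T.filter (· < k)).card :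
        MvPolynomial (Fin n) K) = 1 := by rw [← mul_pow]; simp
      linear_combination (X k * (f T).divMonomial (Finsupp.single k 1)) * hss + h2
    · intro l _ hl
      rw [contract, if_neg (by simp [hk, hl.symm]), mul_zero]

theorem contract_mem_koszulChains {k : Fin n} {i j : ℕ} (hij : i < j)
    {f : Finset (Fin n) → MvPolynomial (Fin n) K} (hf : f ∈ koszulChains ⊤ i j) :
    contract k f ∈ koszulChains ⊤ (i + 1) j := by
  rw [mem_koszulChains hij.le] at hf
  rw [mem_koszulChains hij]
  refine fun T => ⟨trivial, ?_, ?_⟩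
  · rw [contract]
    split_ifs with h
    · have h1 := isHomogeneous_divMonomial_single k (hf (T.erase k)).2.1
      rcases neg_one_pow_eq_or (MvPolynomial (Fin n) K) (T.filter (· < k)).card with e | e
      · rw [e, one_mul, show j - (i + 1) = j - i - 1 by omega]
        exact h1
      · rw [e, neg_one_mul, show j - (i + 1) = j - i - 1 by omega]
        exact h1.neg
    · exact isHomogeneous_zero _ _ _
  · intro hT
    rw [contract]
    split_ifs with h
    · rw [(hf (T.erase k)).2.2, zero_divMonomial, mul_zero]
      rw [Finset.card_erase_of_mem h]
      have := Finset.card_pos.2 ⟨k, h⟩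
      omega
    · rfl

theorem regLE_top : RegLE (⊤ : Ideal (MvPolynomial (Fin n) K)) 0 := by
  intro i j hij z hz
  rw [add_zero] at hij
  -- Modulo boundaries, the variables of `S` can be removed from a cycle one by one, both from its
  -- basis elements and from its coefficients; `freePart k` does not reintroduce those already
  -- removed.
  have key : ∀ S : Finset (Fin n), ∃ w ∈ koszulCycles (⊤ : Ideal (MvPolynomial (Fin n) K)) i j,
      z - w ∈ koszulBoundaries (⊤ : Ideal (MvPolynomial (Fin n) K)) i j ∧
      ∀ k ∈ S, ∀ T, (k ∈ T → w T = 0) ∧ ∀ e, coeff e (w T) ≠ 0 → e k = 0 := by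
    intro S
    induction S using Finset.induction_on with
    | empty => exact ⟨z, hz, by simp, by simp⟩
    | insert k S _ ih =>
      obtain ⟨w, hw, hzw, hS⟩ := ih
      have hd : koszulD n K w = 0 := hw.2
      have h1 := koszulD_contract (k := k) hd
      have h2 : w - freePart k w ∈ koszulBoundaries (⊤ : Ideal (MvPolynomial (Fin n) K)) i j :=
        ⟨contract k w, contract_mem_koszulChains hij hw.1, h1⟩
      have h3 : freePart k w = w - (w - freePart k w) := by abel
      refine ⟨freePart k w, ?_, ?_, ?_⟩
      · rw [h3]
        exact Submodule.sub_mem _ hw (koszulBoundaries_le _ _ _ h2)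
      · have : z - freePart k w = (z - w) + (w - freePart k w) := by abel
        rw [this]
        exact Submodule.add_mem _ hzw h2
      · have hcoeff : ∀ T e, coeff e (freePart k w T) ≠ 0 → e k = 0 ∧ coeff e (w T) ≠ 0 := by
          intro T e he
          rw [freePart] at he
          split_ifs at he with hT
          · simp at he
          · by_cases hle : Finsupp.single k 1 ≤ e
            · rw [coeff_modMonomial_of_le _ hle] at he
              exact absurd rfl he
            · rw [coeff_modMonomial_of_not_le _ hle] at he
              rw [Finsupp.single_le_iff] at hle
              exact ⟨by omega, he⟩
        intro l hl T
        rcases Finset.mem_insert.1 hl with rfl | hl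
        · exact ⟨fun hT => if_pos hT, fun e he => (hcoeff T e he).1⟩
        · refine ⟨fun hT => ?_, fun e he => (hS l hl T).2 e (hcoeff T e he).2⟩
          rw [freePart, (hS l hl T).1 hT]
          ext e
          split_ifs
          · rfl
          · by_cases hle : Finsupp.single k 1 ≤ e
            · rw [coeff_modMonomial_of_le _ hle, coeff_zero]
            · rw [coeff_modMonomial_of_not_le _ hle]
  obtain ⟨w, hw, hzw, h⟩ := key Finset.univ
  -- With no variables left the coefficients are constants, yet homogeneous of degree `j - i > 0`.
  have hw0 : w = 0 := by
    funext T
    ext e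
    rw [Pi.zero_apply, coeff_zero]
    by_contra he
    have he0 : e = 0 := Finsupp.ext fun k => (h k (Finset.mem_univ k) T).2 e he
    have hh := ((mem_koszulChains hij.le).1 hw.1 T).2.1
    refine he (hh.coeff_eq_zero ?_)
    rw [he0, map_zero]
    omega
  rwa [hw0, sub_zero] at hzw

/-! ### Adding a generator -/

/-- If `J` and `J : u` have regularity at most `r` and `r - deg u + 1`, then `J + (u)` has
regularity at most `r`. -/
theorem RegLE.insert_generator {A B : Set (Fin n → ℕ)} {a : Fin n → ℕ} {r s : ℕ}
    (hA : RegLE (monIdeal K A) r) (hB : RegLE (monIdeal K B) s)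
    (hd : ∑ i, a i + s = r + 1) (hs : 1 ≤ s)
    (h1 : ∀ x ∈ A, ∃ b ∈ B, b ≤ x - a) (h2 : ∀ b ∈ B, ∃ x ∈ A, x ≤ b + a) :
    RegLE (monIdeal K (insert a A)) r := by
  intro i j hij z hz
  have hle : monIdeal K A ≤ monIdeal K (insert a A) :=
    Ideal.span_mono (Set.image_mono (Set.subset_insert _ _))
  have hu : mon K a ∈ monIdeal K (insert a A) := mon_mem_monIdeal (Set.mem_insert _ _)
  obtain ⟨hzc, hzd⟩ := hz
  have hzd : koszulD n K z = 0 := hzd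
  generalize hdd : ∑ i, a i = d at hd
  have hz1 := (mem_koszulChains (by omega)).1 hzc
  have hsplit : ∀ T, ∃ p q : MvPolynomial (Fin n) K, p ∈ monIdeal K A ∧ p.IsHomogeneous (j - i) ∧
      q.IsHomogeneous (j - d - i) ∧ z T = p + mon K a * q ∧ (T.card ≠ i → p = 0 ∧ q = 0) := by
    intro T
    by_cases hT : T.card = i
    · obtain ⟨p, q, hp, hp', hq, he⟩ := exists_add_mon_mul hdd (hz1 T).1 (hz1 T).2.1
      exact ⟨p, q, hp, hp', by rwa [Nat.sub_right_comm], he, fun h => absurd hT h⟩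
    · exact ⟨0, 0, zero_mem _, isHomogeneous_zero _ _ _, isHomogeneous_zero _ _ _,
        by simpa using (hz1 T).2.2 hT, fun _ => ⟨rfl, rfl⟩⟩
  choose p q hpA hph hqh hzpq hpq0 using hsplit
  have hq : q ∈ koszulChains (⊤ : Ideal (MvPolynomial (Fin n) K)) i (j - d) :=
    (mem_koszulChains (by omega)).2 fun T => ⟨trivial, hqh T, fun h => (hpq0 T h).2⟩
  have hzeq : z = p + fun T => mon K a * q T := funext hzpq
  -- The connecting map: with `u = mon K a`, `u * dq = -dp` has coefficients in `(A)`, so `dq` is a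
  -- cycle over the colon ideal `(B)`, one homological degree lower. Its degree exceeds the bound
  -- `s`, so it bounds over `(B)`.
  have hw : ∃ w ∈ koszulChains (monIdeal K B) i (j - d), koszulD n K w = koszulD n K q := by
    rcases i with _ | i
    · exact ⟨0, Submodule.zero_mem _, by
        rw [koszulD_eq_zero_of_mem_koszulChains_zero hq, map_zero]⟩
    · have hdq := koszulBoundaries_le _ _ _ (Submodule.mem_map_of_mem (f := koszulD n K) hq)
      have hdqB : ∀ T, koszulD n K q T ∈ monIdeal K B := by
        intro T
        rw [← mon_mul_mem_monIdeal_iff h1 h2]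
        have h3 := congrFun hzd T
        rw [hzeq, map_add, koszulD_mul, Pi.add_apply, Pi.zero_apply] at h3
        rw [eq_neg_of_add_eq_zero_right h3]
        exact neg_mem (koszulD_mem hpA T)
      have hdqc : koszulD n K q ∈ koszulCycles (monIdeal K B) i (j - d) := by
        refine ⟨?_, hdq.2⟩
        have h4 := (mem_koszulChains (by omega)).1 hdq.1
        exact (mem_koszulChains (by omega)).2 fun T => ⟨hdqB T, (h4 T).2⟩
      obtain ⟨w, hw, hwq⟩ := hB i (j - d) (by omega) hdqc
      exact ⟨w, hw, hwq⟩
  obtain ⟨w, hw, hwq⟩ := hw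
  have hw1 := (mem_koszulChains (by omega)).1 hw
  -- Acyclicity over `S` applies to `q - w` because `1 ≤ s` forces `i < j - d`.
  have hqw : q - w ∈ koszulCycles (⊤ : Ideal (MvPolynomial (Fin n) K)) i (j - d) := by
    refine ⟨Submodule.sub_mem _ hq ?_, ?_⟩
    · exact (mem_koszulChains (by omega)).2 fun T => ⟨trivial, (hw1 T).2⟩
    · rw [SetLike.mem_coe, LinearMap.mem_ker, map_sub, hwq, sub_self]
  obtain ⟨v, hv, hvq⟩ := regLE_top i (j - d) (by omega) hqw
  have hv1 := (mem_koszulChains (by omega)).1 hv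
  have huh := isHomogeneous_mon (K := K) a
  rw [hdd] at huh
  -- Up to a boundary, `z` is now a cycle over `(A)`, as `w` has coefficients in the colon ideal.
  have hzv : z - koszulD n K (fun T => mon K a * v T) = p + fun T => mon K a * w T := by
    rw [koszulD_mul, hvq, hzeq]
    funext T
    simp only [Pi.sub_apply, Pi.add_apply]
    ring
  have hy : p + (fun T => mon K a * w T) ∈ koszulCycles (monIdeal K A) i j := by
    constructor
    · refine (mem_koszulChains (by omega)).2 fun T => ⟨?_, ?_, fun hT => ?_⟩
      · exact add_mem (hpA T) ((mon_mul_mem_monIdeal_iff h1 h2).2 (hw1 T).1)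
      · have h5 := huh.mul (hw1 T).2.1
        rw [show d + (j - d - i) = j - i by omega] at h5
        exact (hph T).add h5
      · simp [(hpq0 T hT).1, (hw1 T).2.2 hT]
    · rw [← hzv, SetLike.mem_coe, LinearMap.mem_ker, map_sub, koszulD_koszulD, hzd, sub_zero]
  obtain ⟨y, hy, hyz⟩ := hA i j hij hy
  have hy1 := (mem_koszulChains (by omega)).1 hy
  refine ⟨y + fun T => mon K a * v T, (mem_koszulChains (by omega)).2 fun T => ⟨?_, ?_, ?_⟩, ?_⟩
  · exact add_mem (hle (hy1 T).1) (Ideal.mul_mem_right _ _ hu)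
  · have h5 := huh.mul (hv1 T).2.1
    rw [show d + (j - d - (i + 1)) = j - (i + 1) by omega] at h5
    exact (hy1 T).2.1.add h5
  · intro hT
    simp [(hy1 T).2.2 hT, (hv1 T).2.2 hT]
  · rw [map_add, hyz, ← hzv, sub_add_cancel]

/-! ### Ideals generated by variables -/

/-- The exponent vectors of the variables in `V`. -/
abbrev varExp (V : Set (Fin n)) : Set (Fin n → ℕ) := (fun v => Pi.single v 1) '' V

theorem single_one_le_iff {v : Fin n} {x : Fin n → ℕ} : Pi.single v 1 ≤ x ↔ 1 ≤ x v := by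
  constructor
  · intro h
    simpa using h v
  · intro h i
    rcases eq_or_ne i v with rfl | hi
    · simpa using h
    · simp [hi]

/-- Coning off a new variable leaves the colon ideal equal to the old ideal, so the bound `1` is
stable under induction. -/
theorem regLE_varExp (V : Set (Fin n)) : RegLE (monIdeal K (varExp V)) 1 := by
  classical
  have key : ∀ S : Finset (Fin n), RegLE (monIdeal K (varExp (S : Set (Fin n)))) 1 := by
    intro S
    induction S using Finset.induction_on with
    | empty => simpa [varExp] using regLE_bot 1
    | insert w S hw ih =>
      rw [Finset.coe_insert, varExp, Set.image_insert_eq]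
      refine ih.insert_generator ih (by simp) le_rfl ?_ ?_
      · rintro _ ⟨v, hv, rfl⟩
        have hvw : v ≠ w := fun h => hw (by simpa [h] using hv)
        exact ⟨_, ⟨v, hv, rfl⟩, single_one_le_iff.2 (by simp [hvw])⟩
      · rintro b hb
        exact ⟨b, hb, le_self_add⟩
  have := key V.toFinite.toFinset
  rwa [Set.Finite.coe_toFinset] at this

theorem span_X_image_eq (V : Set (Fin n)) :
    Ideal.span ((fun v => (X v : MvPolynomial (Fin n) K)) '' V) = monIdeal K (varExp V) := by
  rw [monIdeal, varExp, Set.image_image]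
  refine congrArg Ideal.span (Set.image_congr fun v _ => ?_)
  rw [mon, Finsupp.equivFunOnFinite_symm_single, X]

theorem varColon_left {A : Set (Fin n → ℕ)} {a : Fin n → ℕ} {V : Set (Fin n)}
    (h : ∀ x ∈ A, ∃ v ∈ V, a v < x v) : ∀ x ∈ A, ∃ b ∈ varExp V, b ≤ x - a := by
  intro x hx
  obtain ⟨v, hv, hvx⟩ := h x hx
  exact ⟨_, ⟨v, hv, rfl⟩, single_one_le_iff.2 (by simp only [Pi.sub_apply]; omega)⟩

theorem varColon_right {A : Set (Fin n → ℕ)} {a : Fin n → ℕ} {V : Set (Fin n)}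
    (h : ∀ v ∈ V, ∃ x ∈ A, ∀ i, x i ≤ a i + if i = v then 1 else 0) :
    ∀ b ∈ varExp V, ∃ x ∈ A, x ≤ b + a := by
  rintro _ ⟨v, hv, rfl⟩
  obtain ⟨x, hx, hxv⟩ := h v hv
  refine ⟨x, hx, fun i => (hxv i).trans ?_⟩
  simp only [Pi.add_apply, Pi.single_apply]
  omega

/-- Adding a generator of degree at most `r` whose colon ideal is generated by variables preserves
regularity at most `r`. -/
theorem RegLE.insert_of_varColon {A : Set (Fin n → ℕ)} {a : Fin n → ℕ} {r : ℕ}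
    (hA : RegLE (monIdeal K A) r) (V : Set (Fin n)) (hd : ∑ i, a i ≤ r)
    (h1 : ∀ x ∈ A, ∃ v ∈ V, a v < x v)
    (h2 : ∀ v ∈ V, ∃ x ∈ A, ∀ i, x i ≤ a i + if i = v then 1 else 0) :
    RegLE (monIdeal K (insert a A)) r :=
  hA.insert_generator (s := r + 1 - ∑ i, a i) ((regLE_varExp V).mono (by omega)) (by omega)
    (by omega) (varColon_left h1) (varColon_right h2)

/-! ### Nonvanishing Betti numbers -/

/-- `finrank` is `0` on infinite-dimensional spaces, so finiteness is needed for a nonzero Tor to be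
seen by `betti`. -/
instance (I : Ideal (MvPolynomial (Fin n) K)) (i j : ℕ) :
    Module.Finite K (koszulCycles I i j) := by
  have h1 : Module.Finite K (homogeneousSubmodule (Fin n) K (j - i)) :=
    Module.Finite.iff_fg.2 (homogeneousSubmodule_fg _ K _)
  let φ : koszulCycles I i j →ₗ[K]
      (Finset (Fin n) → homogeneousSubmodule (Fin n) K (j - i)) :=
    LinearMap.pi fun T => LinearMap.codRestrict _
      (LinearMap.proj T ∘ₗ (koszulCycles I i j).subtype) fun f => by
        have hf := f.2.1
        simp only [koszulChains, SetLike.mem_coe, Submodule.mem_pi, Set.mem_univ,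
          true_implies] at hf
        have hT := hf T
        split_ifs at hT with h
        · exact hT.2
        · rw [Submodule.mem_bot] at hT
          change f.1 T ∈ _
          rw [hT]
          exact Submodule.zero_mem _
  refine Module.Finite.of_injective φ fun f g hfg => Subtype.ext (funext fun T => ?_)
  exact congrArg Subtype.val (congrFun hfg T)

theorem betti_ne_zero_iff {I : Ideal (MvPolynomial (Fin n) K)} {i j : ℕ} :
    betti I i j ≠ 0 ↔ ¬ koszulCycles I i j ≤ koszulBoundaries I i j := by
  rw [betti, ne_eq, Module.finrank_zero_iff, Submodule.Quotient.subsingleton_iff,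
    Submodule.submoduleOf_eq_top]

theorem hasRegularity_of_regLE {I : Ideal (MvPolynomial (Fin n) K)} {r i : ℕ} (h : RegLE I r)
    (hi : ¬ koszulCycles I i (i + r) ≤ koszulBoundaries I i (i + r)) : HasRegularity I r := by
  constructor
  · exact ⟨i, i + r, betti_ne_zero_iff.2 hi, by push_cast; ring⟩
  · rintro d ⟨i', j, hij, rfl⟩
    by_contra hlt
    exact betti_ne_zero_iff.1 hij (h i' j (by omega))

theorem exists_coeff_ne_zero_of_coeff_X_mul {k : Fin n} {e : Fin n →₀ ℕ} {m : ℕ}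
    {f : MvPolynomial (Fin n) K} (h : coeff e ((-1) ^ m * X k * f) ≠ 0) :
    e k ≠ 0 ∧ coeff (e - Finsupp.single k 1) f ≠ 0 := by
  have h' : coeff e (X k * f) ≠ 0 := by
    rw [mul_assoc] at h
    rcases neg_one_pow_eq_or (MvPolynomial (Fin n) K) m with hm | hm
    · rwa [hm, one_mul] at h
    · rw [hm, neg_one_mul, coeff_neg] at h
      exact neg_ne_zero.1 h
  classical
  rw [coeff_X_mul'] at h'
  split_ifs at h' with hk
  · exact ⟨Finsupp.mem_support_iff.1 hk, h'⟩
  · exact absurd rfl h'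

/-- A minimal generator gives a nonzero class in `Tor_0`. -/
theorem not_koszulCycles_le_of_minimal {A : Set (Fin n → ℕ)} {a : Fin n → ℕ} {r : ℕ} (ha : a ∈ A)
    (hmin : ∀ x ∈ A, x ≤ a → x = a) (hr : ∑ i, a i = r) :
    ¬ koszulCycles (monIdeal K A) 0 (0 + r) ≤ koszulBoundaries (monIdeal K A) 0 (0 + r) := by
  intro hle
  have hz : Pi.single ∅ (mon K a) ∈ koszulChains (monIdeal K A) 0 (0 + r) := by
    refine (mem_koszulChains (Nat.zero_le _)).2 fun T => ?_
    rcases eq_or_ne T ∅ with rfl | hT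
    · rw [Pi.single_eq_same]
      refine ⟨mon_mem_monIdeal ha, ?_, fun h => absurd rfl h⟩
      rw [zero_add, Nat.sub_zero, ← hr]
      exact isHomogeneous_mon a
    · rw [Pi.single_eq_of_ne hT]
      exact ⟨zero_mem _, isHomogeneous_zero _ _ _, fun _ => rfl⟩
  obtain ⟨g, hg, hgz⟩ := hle ⟨hz, koszulD_eq_zero_of_mem_koszulChains_zero hz⟩
  have h1 : coeff (Finsupp.equivFunOnFinite.symm a) (koszulD n K g ∅) ≠ 0 := by
    rw [hgz, Pi.single_eq_same, mon, coeff_monomial, if_pos rfl]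
    exact one_ne_zero
  rw [koszulD_apply, coeff_sum] at h1
  obtain ⟨k, _, hk⟩ := Finset.exists_ne_zero_of_sum_ne_zero h1
  obtain ⟨hak, hk⟩ := exists_coeff_ne_zero_of_coeff_X_mul hk
  -- If the class were a boundary, `x^a / x_k` would lie in the ideal for some `k`, against
  -- minimality of `a`.
  obtain ⟨x, hx, hxe⟩ := mem_monIdeal.1 (mem_of_mem_koszulChains hg (insert k ∅)) _
    (mem_support_iff.2 hk)
  have hxa := hmin x hx (hxe.trans fun i => by simp)
  have := hxe k
  simp only [hxa, Finsupp.coe_tsub, Pi.sub_apply, Finsupp.coe_equivFunOnFinite_symm,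
    Finsupp.single_eq_same] at this hak
  omega

/-- A monomial in the socle of `S / I` gives a nonzero class in `Tor_{n-1}`. -/
theorem not_koszulCycles_le_of_socle {I : Ideal (MvPolynomial (Fin n) K)} {e : Fin n → ℕ}
    {i r : ℕ} (hi : i + 1 = n) (he : mon K e ∉ I) (hX : ∀ k, X k * mon K e ∈ I)
    (hr : ∑ i, e i + 1 = r) :
    ¬ koszulCycles I i (i + r) ≤ koszulBoundaries I i (i + r) := by
  intro hle
  -- The cycle is the differential of `x^e e_univ`: a boundary over `S`, with coefficients `± x_k
  -- x^e` in `I`.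
  have hu : Pi.single Finset.univ (mon K e) ∈
      koszulChains (⊤ : Ideal (MvPolynomial (Fin n) K)) (i + 1) (i + r) := by
    refine (mem_koszulChains (by omega)).2 fun T => ?_
    rcases eq_or_ne T Finset.univ with rfl | hT
    · rw [Pi.single_eq_same]
      refine ⟨trivial, ?_, fun h => absurd (by simp [hi]) h⟩
      rw [show i + r - (i + 1) = ∑ i, e i by omega]
      exact isHomogeneous_mon e
    · rw [Pi.single_eq_of_ne hT]
      exact ⟨trivial, isHomogeneous_zero _ _ _, fun _ => rfl⟩
  have hz := koszulBoundaries_le _ _ _ (Submodule.mem_map_of_mem (f := koszulD n K) hu)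
  have hzI : koszulD n K (Pi.single Finset.univ (mon K e)) ∈ koszulCycles I i (i + r) := by
    refine ⟨(mem_koszulChains (by omega)).2 fun T =>
      ⟨?_, ((mem_koszulChains (by omega)).1 hz.1 T).2⟩, hz.2⟩
    refine Submodule.sum_mem _ fun k _ => ?_
    rcases eq_or_ne (insert k T) Finset.univ with hT | hT
    · rw [hT, Pi.single_eq_same, mul_assoc]
      exact I.mul_mem_left _ (hX k)
    · rw [Pi.single_eq_of_ne hT, mul_zero]
      exact zero_mem _
  obtain ⟨g, hg, hgz⟩ := hle hzI
  have hn : 0 < n := by omega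
  let k : Fin n := ⟨0, hn⟩
  -- The differential is injective in top degree: cancelling `± x_k` would give `x^e = g univ ∈ I`.
  have hk := congrFun hgz (Finset.univ.erase k)
  have hc : (Finset.univ.erase k)ᶜ = {k} := by
    ext x
    simp
  rw [koszulD_apply, koszulD_apply, hc, Finset.sum_singleton, Finset.sum_singleton,
    Finset.insert_erase (Finset.mem_univ k), Pi.single_eq_same] at hk
  have hne : ((-1) ^ ((Finset.univ.erase k).filter (· < k)).card * X k :
      MvPolynomial (Fin n) K) ≠ 0 :=
    mul_ne_zero (pow_ne_zero _ (neg_ne_zero.2 one_ne_zero)) (X_ne_zero k)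
  exact he (mul_left_cancel₀ hne hk ▸ mem_of_mem_koszulChains hg Finset.univ)

/-! ### Gradient ideals of monomial ideals -/

theorem mem_minGens_monIdeal {A : Set (Fin n → ℕ)} (hA : ∀ a ∈ A, ∀ b ∈ A, b ≤ a → b = a)
    {e : Fin n →₀ ℕ} : e ∈ minGens (monIdeal K A) ↔ ⇑e ∈ A := by
  rw [minGens, Set.mem_ofPred_eq, minimal_iff]
  simp only [monomial_mem_monIdeal (one_ne_zero : (1 : K) ≠ 0)]
  constructor
  · rintro ⟨⟨a, ha, hae⟩, hmin⟩
    have : e = Finsupp.equivFunOnFinite.symm a := hmin ⟨a, ha, le_rfl⟩ hae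
    rw [this]
    exact ha
  · refine fun he => ⟨⟨e, he, le_rfl⟩, ?_⟩
    rintro b ⟨a, ha, hab⟩ hbe
    have hae := hA _ he a ha (hab.trans hbe)
    exact le_antisymm (fun i => by rw [← hae]; exact hab i) hbe

theorem gradient_le_gradientStar (I : Ideal (MvPolynomial (Fin n) K)) :
    gradient I ≤ gradientStar I := by
  rw [gradient, Ideal.span_le]
  rintro _ ⟨a, ha, i, rfl⟩
  rw [pderiv_monomial, one_mul]
  by_cases hi : a i = 0
  · simp [hi]
  · have h : monomial (a - Finsupp.single i 1) (1 : K) ∈ gradientStar I :=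
      Ideal.subset_span ⟨a, ha, i, Finsupp.mem_support_iff.2 hi, rfl⟩
    have h2 := Ideal.mul_mem_left _ (C (a i : K)) h
    rwa [C_mul_monomial, mul_one] at h2

theorem gradientStar_monIdeal_le {A G : Set (Fin n → ℕ)}
    (hA : ∀ a ∈ A, ∀ b ∈ A, b ≤ a → b = a)
    (h1 : ∀ a ∈ A, ∀ i, a i ≠ 0 → ∃ g ∈ G, ∀ j, g j ≤ a j - if j = i then 1 else 0) :
    gradientStar (monIdeal K A) ≤ monIdeal K G := by
  rw [gradientStar, Ideal.span_le]
  rintro _ ⟨a, ha, i, hi, rfl⟩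
  rw [mem_minGens_monIdeal hA] at ha
  obtain ⟨g, hg, hga⟩ := h1 _ ha i (Finsupp.mem_support_iff.1 hi)
  refine (monomial_mem_monIdeal one_ne_zero).2 ⟨g, hg, fun j => (hga j).trans ?_⟩
  rw [Finsupp.tsub_apply, Finsupp.single_apply]
  simp only [eq_comm, le_refl]

/-- Since `∂_i x^a = a_i x^a / x_i`, the exponent `a_i` must be invertible in `K`; this is where the
characteristic enters. -/
theorem monIdeal_le_gradient {A G : Set (Fin n → ℕ)} (hA : ∀ a ∈ A, ∀ b ∈ A, b ≤ a → b = a)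
    (h2 : ∀ g ∈ G, ∃ a ∈ A, ∃ i, (a i : K) ≠ 0 ∧ ∀ j, a j - (if j = i then 1 else 0) ≤ g j) :
    monIdeal K G ≤ gradient (monIdeal K A) := by
  rw [monIdeal, Ideal.span_le]
  rintro _ ⟨g, hg, rfl⟩
  obtain ⟨a, ha, i, hi, hag⟩ := h2 g hg
  let a' := Finsupp.equivFunOnFinite.symm a
  have hle : a' - Finsupp.single i 1 ≤ Finsupp.equivFunOnFinite.symm g := by
    intro j
    refine le_trans (le_of_eq ?_) (hag j)
    rw [Finsupp.tsub_apply, Finsupp.single_apply]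
    simp only [eq_comm]
    rfl
  have h : pderiv i (monomial a' (1 : K)) ∈ gradient (monIdeal K A) :=
    Ideal.subset_span ⟨a', (mem_minGens_monIdeal hA).2 ha, i, rfl⟩
  rw [pderiv_monomial, one_mul] at h
  have h3 := Ideal.mul_mem_left _
    (monomial (Finsupp.equivFunOnFinite.symm g - (a' - Finsupp.single i 1)) (a i : K)⁻¹) h
  rwa [monomial_mul, tsub_add_cancel_of_le hle,
    show (a i : K)⁻¹ * (a' i : K) = 1 from inv_mul_cancel₀ hi] at h3

theorem monIdeal_le_gradientStar {A G : Set (Fin n → ℕ)}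
    (hA : ∀ a ∈ A, ∀ b ∈ A, b ≤ a → b = a)
    (h2 : ∀ g ∈ G, ∃ a ∈ A, ∃ i, a i ≠ 0 ∧ ∀ j, a j - (if j = i then 1 else 0) ≤ g j) :
    monIdeal K G ≤ gradientStar (monIdeal K A) := by
  refine (monIdeal_mono_of (B := {x | ∃ a ∈ A, ∃ i, a i ≠ 0 ∧ x = a - Pi.single i 1})
    fun g hg => ?_).trans ?_
  · obtain ⟨a, ha, i, hi, hag⟩ := h2 g hg
    refine ⟨_, ⟨a, ha, i, hi, rfl⟩, fun j => ?_⟩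
    rw [Pi.sub_apply, Pi.single_apply]
    exact hag j
  · rw [monIdeal, Ideal.span_le]
    rintro _ ⟨_, ⟨a, ha, i, hi, rfl⟩, rfl⟩
    refine Ideal.subset_span ⟨Finsupp.equivFunOnFinite.symm a, (mem_minGens_monIdeal hA).2 ha, i,
      Finsupp.mem_support_iff.2 hi, ?_⟩
    rw [mon, ← Finsupp.equivFunOnFinite_symm_single]
    refine congrArg (fun e => monomial e (1 : K)) (Finsupp.ext fun j => ?_)
    rfl

/-! ### Regular sequences of powers of variables -/

/-- A power of a variable absent from the generators is coprime to all of them, so the colon ideal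
is unchanged. -/
theorem isSMulRegular_X_pow_quotient_monIdeal {A : Set (Fin n → ℕ)} {k : Fin n} (m : ℕ)
    (hA : ∀ a ∈ A, a k = 0) :
    IsSMulRegular (MvPolynomial (Fin n) K ⧸ monIdeal K A) (X k ^ m : MvPolynomial (Fin n) K) := by
  rw [isSMulRegular_quotient_iff_mem_of_smul_mem]
  intro f hf
  have hX : (X k ^ m : MvPolynomial (Fin n) K) = mon K (Pi.single k m) := by
    rw [mon, Finsupp.equivFunOnFinite_symm_single, X_pow_eq_monomial]
  rw [smul_eq_mul, hX] at hf
  refine (mon_mul_mem_monIdeal_iff (fun x hx => ⟨x, hx, fun i => ?_⟩)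
    (fun b hb => ⟨b, hb, le_self_add⟩)).1 hf
  rcases eq_or_ne i k with rfl | hi
  · simp [hA x hx]
  · simp [hi]

/-! ### The ideal `(x_1 x_2, x_1 x_3^b, x_2 x_4^b)` -/

/-- The exponent vectors of the generators of `negIdeal`. -/
def negExp (b : ℕ) : Set (Fin 4 → ℕ) := {![0, 1, 0, b], ![1, 0, b, 0], ![1, 1, 0, 0]}

/-- The exponent vectors of the generators of the gradient ideal of `negIdeal`. -/
def negGradExp (b : ℕ) : Set (Fin 4 → ℕ) :=
  {![0, 0, 0, b], ![0, 0, b, 0], ![0, 1, 0, 0], ![1, 0, 0, 0]}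

theorem negIdeal_eq_monIdeal (b : ℕ) : negIdeal K b = monIdeal K (negExp b) := by
  rw [negIdeal, monIdeal, negExp]
  simp only [Set.image_insert_eq, Set.image_singleton, mon_eq_prod, Fin.prod_univ_four]
  congr 1
  ext p
  simp
  tauto

theorem negExp_minimal {b : ℕ} (hb : 2 ≤ b) :
    ∀ x ∈ negExp b, ∀ y ∈ negExp b, y ≤ x → y = x := by
  have h1 : ¬ b ≤ 1 := by omega
  have h0 : ¬ b ≤ 0 := by omega
  simp [negExp, Pi.le_def, Fin.forall_fin_succ]
  omega

theorem regLE_negExp_pair {b : ℕ} (hb : 2 ≤ b) :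
    RegLE (monIdeal K ({![1, 0, b, 0], ![1, 1, 0, 0]} : Set (Fin 4 → ℕ))) (b + 1) := by
  -- Generators are added from the right of the set: `x_1 x_2`, then `x_1 x_3^b` with colon ideal
  -- `(x_2)`.
  rw [← insert_empty_eq (![1, 1, 0, 0] : Fin 4 → ℕ)]
  refine RegLE.insert_of_varColon (RegLE.insert_of_varColon ?_ ∅ ?_ ?_ ?_) {1} ?_ ?_ ?_
  · rw [monIdeal_empty]
    exact regLE_bot _
  all_goals simp [Fin.sum_univ_four, Fin.forall_fin_succ]
  all_goals omega

theorem regLE_negExp {b : ℕ} (hb : 2 ≤ b) : RegLE (monIdeal K (negExp b)) (b + 1) := by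
  refine RegLE.insert_of_varColon (regLE_negExp_pair hb) {0} ?_ ?_ ?_
  all_goals simp [Fin.sum_univ_four, Fin.forall_fin_succ]
  all_goals omega

theorem hasRegularity_negIdeal {b : ℕ} (hb : 2 ≤ b) : HasRegularity (negIdeal K b) (b + 1) := by
  rw [negIdeal_eq_monIdeal]
  have ha : ![1, 0, b, 0] ∈ negExp b := by simp [negExp]
  exact_mod_cast hasRegularity_of_regLE (regLE_negExp hb)
    (not_koszulCycles_le_of_minimal ha (negExp_minimal hb _ ha)
      (by simp [Fin.sum_univ_four]; omega))

theorem hasLinearQuotients_negIdeal {b : ℕ} (hb : 2 ≤ b) :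
    HasLinearQuotients (negIdeal K b) := by
  let u : Fin 3 → (Fin 4 → ℕ) := ![![1, 1, 0, 0], ![1, 0, b, 0], ![0, 1, 0, b]]
  refine ⟨3, fun i => Finsupp.equivFunOnFinite.symm (u i), ?_, ?_, ?_⟩
  · refine Finsupp.equivFunOnFinite.symm.injective.comp ?_
    intro i j h
    fin_cases i <;> fin_cases j <;> simp [u] at h ⊢
  · ext e
    rw [negIdeal_eq_monIdeal, mem_minGens_monIdeal (negExp_minimal hb)]
    simp only [Set.mem_range, Equiv.symm_apply_eq]
    change (∃ y, u y = ⇑e) ↔ _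
    simp [Fin.exists_fin_succ, u, negExp, eq_comm]
    tauto
  · have hset : ∀ k : Fin 3, {p | ∃ l : Fin 3, l < k ∧
        p = monomial (Finsupp.equivFunOnFinite.symm (u l)) (1 : K)} =
          mon K '' {x | ∃ l < k, x = u l} := by
      intro k
      ext p
      constructor
      · rintro ⟨l, hl, rfl⟩
        exact ⟨_, ⟨l, hl, rfl⟩, rfl⟩
      · rintro ⟨_, ⟨l, hl, rfl⟩, rfl⟩
        exact ⟨l, hl, rfl⟩
    have key : ∀ (k : Fin 3) (V : Set (Fin 4)), (∀ l < k, ∃ v ∈ V, u k v < u l v) →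
        (∀ v ∈ V, ∃ l < k, ∀ i, u l i ≤ u k i + if i = v then 1 else 0) →
        (Ideal.span {p | ∃ l : Fin 3, l < k ∧
          p = monomial (Finsupp.equivFunOnFinite.symm (u l)) (1 : K)}).colon
          {monomial (Finsupp.equivFunOnFinite.symm (u k)) (1 : K)} =
          Ideal.span ((fun v => (X v : MvPolynomial (Fin 4) K)) '' V) := by
      intro k V h1 h2
      rw [hset, span_X_image_eq]
      refine colon_monIdeal (varColon_left ?_) (varColon_right ?_)
      · rintro _ ⟨l, hl, rfl⟩
        exact h1 l hl
      · intro v hv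
        obtain ⟨l, hl, h⟩ := h2 v hv
        exact ⟨_, ⟨l, hl, rfl⟩, h⟩
    intro k hk
    obtain rfl | rfl : k = 1 ∨ k = 2 := by omega
    · refine ⟨{1}, key _ _ ?_ ?_⟩ <;> simp [u, Fin.forall_fin_succ]
    · refine ⟨{0}, key _ _ ?_ ?_⟩ <;> simp [u, Fin.forall_fin_succ, Fin.exists_fin_succ]

theorem gradient_negIdeal {b : ℕ} (hb : 2 ≤ b) :
    gradient (negIdeal K b) = monIdeal K (negGradExp b) ∧
      gradient (negIdeal K b) = gradientStar (negIdeal K b) := by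
  rw [negIdeal_eq_monIdeal]
  have h1 := gradientStar_monIdeal_le (K := K) (negExp_minimal hb) (G := negGradExp b) (by
    simp [negExp, negGradExp, Fin.forall_fin_succ])
  have h2 := monIdeal_le_gradient (K := K) (negExp_minimal hb) (G := negGradExp b) (by
    simp [negExp, negGradExp, Fin.forall_fin_succ, Fin.exists_fin_succ])
  have h3 := gradient_le_gradientStar (monIdeal K (negExp b))
  exact ⟨le_antisymm (h3.trans h1) h2, le_antisymm h3 (h1.trans h2)⟩

/-- Each pure power of degree `b` is coprime to the earlier generators, so it raises the bound by `b
- 1`: from `1` to `b` to `2b - 1`. -/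
theorem regLE_negGradExp {b : ℕ} (hb : 2 ≤ b) :
    RegLE (monIdeal K (negGradExp b)) (2 * b - 1) := by
  have h0 : RegLE (monIdeal K ({![0, 1, 0, 0], ![1, 0, 0, 0]} : Set (Fin 4 → ℕ))) 1 := by
    have h := regLE_varExp (K := K) ({1, 0} : Set (Fin 4))
    have e0 : (Pi.single 0 1 : Fin 4 → ℕ) = ![1, 0, 0, 0] := by decide
    have e1 : (Pi.single 1 1 : Fin 4 → ℕ) = ![0, 1, 0, 0] := by decide
    rwa [varExp, Set.image_insert_eq, Set.image_singleton, e0, e1] at h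
  have h1 : RegLE (monIdeal K ({![0, 0, b, 0], ![0, 1, 0, 0], ![1, 0, 0, 0]} :
      Set (Fin 4 → ℕ))) b := by
    refine RegLE.insert_generator (h0.mono (by omega)) h0 (by simp [Fin.sum_univ_four]) le_rfl ?_ ?_
    all_goals simp [Pi.le_def, Fin.forall_fin_succ]
  refine RegLE.insert_generator (h1.mono (by omega)) h1 (by simp [Fin.sum_univ_four]; omega)
    (by omega) ?_ ?_
  all_goals simp [Pi.le_def, Fin.forall_fin_succ]

theorem X_mul_mon_mem_monIdeal {A : Set (Fin n → ℕ)} {e : Fin n → ℕ} {k : Fin n}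
    (h : ∃ x ∈ A, ∀ i, x i ≤ e i + if i = k then 1 else 0) : X k * mon K e ∈ monIdeal K A := by
  rw [X, monomial_mul, mul_one, monomial_mem_monIdeal one_ne_zero]
  obtain ⟨x, hx, hxe⟩ := h
  refine ⟨x, hx, fun i => (hxe i).trans (le_of_eq ?_)⟩
  rw [Finsupp.add_apply, Finsupp.single_apply, add_comm]
  simp only [eq_comm]
  rfl

theorem hasRegularity_monIdeal_negGradExp {b : ℕ} (hb : 2 ≤ b) :
    HasRegularity (monIdeal K (negGradExp b)) ((2 * b - 1 : ℕ) : ℤ) := by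
  refine hasRegularity_of_regLE (regLE_negGradExp hb)
    -- `x_3^(b-1) x_4^(b-1)` spans the socle of the quotient by `(x_1, x_2, x_3^b, x_4^b)`.
    (not_koszulCycles_le_of_socle (e := ![0, 0, b - 1, b - 1]) (i := 3) rfl ?_ ?_ ?_)
  · rw [monomial_mem_monIdeal one_ne_zero]
    simp [negGradExp, Pi.le_def, Fin.forall_fin_succ]
    omega
  · intro k
    refine X_mul_mon_mem_monIdeal ?_
    fin_cases k <;> simp [negGradExp, Fin.forall_fin_succ] <;> omega
  · simp [Fin.sum_univ_four]
    omega

theorem isCompleteIntersection_monIdeal_negGradExp {b : ℕ} (hb : 2 ≤ b) :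
    IsCompleteIntersection (monIdeal K (negGradExp b)) := by
  have hs : ∀ (k : Fin 4) (m : ℕ), mon K (Pi.single k m) = X k ^ m := by
    intro k m
    rw [mon, Finsupp.equivFunOnFinite_symm_single, X_pow_eq_monomial]
  have hlist : ∀ l : List (Fin 4 → ℕ), Ideal.ofList (l.map (mon K)) = monIdeal K {x | x ∈ l} := by
    intro l
    rw [Ideal.ofList, monIdeal]
    congr 1
    ext p
    simp
  let l : List (Fin 4 → ℕ) := [Pi.single 0 1, Pi.single 1 1, Pi.single 2 b, Pi.single 3 b]
  have hl : monIdeal K (negGradExp b) = monIdeal K {x | x ∈ l} := by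
    have e0 : (Pi.single 0 1 : Fin 4 → ℕ) = ![1, 0, 0, 0] := by decide
    have e1 : (Pi.single 1 1 : Fin 4 → ℕ) = ![0, 1, 0, 0] := by decide
    have e2 : (Pi.single 2 b : Fin 4 → ℕ) = ![0, 0, b, 0] := by
      funext i; fin_cases i <;> simp
    have e3 : (Pi.single 3 b : Fin 4 → ℕ) = ![0, 0, 0, b] := by
      funext i; fin_cases i <;> simp
    congr 1
    ext x
    simp only [l, e0, e1, e2, e3, negGradExp, Set.mem_insert_iff, Set.mem_singleton_iff,
      Set.mem_ofPred_eq, List.mem_cons, List.not_mem_nil, or_false]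
    tauto
  refine ⟨l.map (mon K), ⟨⟨fun i hi => ?_⟩, ?_⟩, by rw [hl, hlist]⟩
  · rw [smul_eq_mul, Ideal.mul_top, ← List.map_take, hlist]
    have hi4 : i < 4 := by simpa [l] using hi
    rw [List.getElem_map]
    interval_cases i
    all_goals
      simp only [l, List.getElem_cons_zero, List.getElem_cons_succ]
      rw [hs]
      refine isSMulRegular_X_pow_quotient_monIdeal _ ?_
      simp
  · rw [smul_eq_mul, Ideal.mul_top, hlist, ← hl]
    intro h
    have h1 : (monomial 0 1 : MvPolynomial (Fin 4) K) ∈ monIdeal K (negGradExp b) := by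
      rw [← h]; trivial
    rw [monomial_mem_monIdeal one_ne_zero] at h1
    have h2 : ∃ a ∈ negGradExp b, ∀ i, a i ≤ 0 := h1
    simp [negGradExp, Fin.forall_fin_succ] at h2
    omega

/-! ### The path ideal -/

/-- The exponent vectors of the generators of `pathIdeal`. -/
def pathExp : List (Fin 6 → ℕ) :=
  [![0, 0, 0, 1, 1, 1], ![0, 0, 1, 1, 1, 0], ![0, 1, 1, 1, 0, 0], ![1, 1, 1, 0, 0, 0]]

/-- The exponent vectors of the generators of the gradient ideal of `pathIdeal`. -/
def pathGradExp : List (Fin 6 → ℕ) :=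
  [![0, 0, 0, 0, 1, 1], ![0, 0, 0, 1, 0, 1], ![0, 0, 0, 1, 1, 0], ![0, 0, 1, 0, 1, 0],
    ![0, 0, 1, 1, 0, 0], ![0, 1, 0, 1, 0, 0], ![0, 1, 1, 0, 0, 0], ![1, 0, 1, 0, 0, 0],
    ![1, 1, 0, 0, 0, 0]]

/-- The monomial ideal generated by a list of monomials. -/
abbrev listIdeal (K : Type*) [Field K] (l : List (Fin n → ℕ)) : Ideal (MvPolynomial (Fin n) K) :=
  monIdeal K {x | x ∈ l}

theorem setOf_mem_cons (a : Fin n → ℕ) (l : List (Fin n → ℕ)) :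
    {x | x ∈ a :: l} = insert a {x | x ∈ l} := by
  ext x
  simp

theorem regLE_listIdeal_nil (r : ℕ) : RegLE (listIdeal K ([] : List (Fin n → ℕ))) r := by
  have : {x : Fin n → ℕ | x ∈ ([] : List (Fin n → ℕ))} = ∅ := by
    ext x
    simp
  rw [listIdeal, this, monIdeal_empty]
  exact regLE_bot r

/-- Lists in place of sets make the side conditions decidable for concrete exponents. The head of
the list is the generator added last. -/
theorem RegLE.cons {l : List (Fin n → ℕ)} {a : Fin n → ℕ} {r : ℕ}
    (hl : RegLE (listIdeal K l) r) (V : List (Fin n)) (hd : ∑ i, a i ≤ r)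
    (h1 : ∀ x ∈ l, ∃ v ∈ V, a v < x v)
    (h2 : ∀ v ∈ V, ∃ x ∈ l, ∀ i, x i ≤ a i + if i = v then 1 else 0) :
    RegLE (listIdeal K (a :: l)) r := by
  rw [listIdeal, setOf_mem_cons]
  exact hl.insert_of_varColon {v | v ∈ V} hd h1 h2

theorem pathIdeal_eq_listIdeal : pathIdeal K = listIdeal K pathExp := by
  have h : ∀ i j k : Fin 6, X i * X j * X k =
      mon K (Pi.single i 1 + Pi.single j 1 + Pi.single k 1) := by
    intro i j k
    rw [X, X, X, monomial_mul, monomial_mul, mul_one, mul_one]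
    simp only [← Finsupp.equivFunOnFinite_symm_single]
    exact congrArg (fun e => monomial e (1 : K)) (Finsupp.ext fun _ => rfl)
  have e : {x | x ∈ pathExp} = {![1, 1, 1, 0, 0, 0], ![0, 1, 1, 1, 0, 0], ![0, 0, 1, 1, 1, 0],
      ![0, 0, 0, 1, 1, 1]} := by
    ext x
    simp only [pathExp, List.mem_cons, List.not_mem_nil, or_false, Set.mem_ofPred_eq,
      Set.mem_insert_iff, Set.mem_singleton_iff]
    tauto
  rw [pathIdeal, listIdeal, monIdeal, e]
  simp only [Set.image_insert_eq, Set.image_singleton, h]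
  congr 6 <;> decide

theorem pathExp_minimal : ∀ x ∈ pathExp, ∀ y ∈ pathExp, y ≤ x → y = x := by
  simp only [Pi.le_def]
  decide

theorem hasRegularity_pathIdeal : HasRegularity (pathIdeal K) 3 := by
  rw [pathIdeal_eq_listIdeal]
  have h : RegLE (listIdeal K pathExp) 3 := by
    refine RegLE.cons (RegLE.cons (RegLE.cons (RegLE.cons (regLE_listIdeal_nil _) [] ?_ ?_ ?_)
      [0] ?_ ?_ ?_) [1] ?_ ?_ ?_) [2] ?_ ?_ ?_
    all_goals decide
  have ha : ![1, 1, 1, 0, 0, 0] ∈ pathExp := by decide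
  exact hasRegularity_of_regLE h
    (not_koszulCycles_le_of_minimal ha (pathExp_minimal _ ha) (by decide))

theorem gradient_pathIdeal :
    gradient (pathIdeal K) = listIdeal K pathGradExp ∧
      gradient (pathIdeal K) = gradientStar (pathIdeal K) := by
  rw [pathIdeal_eq_listIdeal]
  have h1 := gradientStar_monIdeal_le (K := K) pathExp_minimal (G := {x | x ∈ pathGradExp}) (by
    change ∀ a ∈ pathExp, ∀ i, a i ≠ 0 → ∃ g ∈ pathGradExp, ∀ j, g j ≤ a j - if j = i then 1 else 0
    decide)
  have h2 := monIdeal_le_gradient (K := K) pathExp_minimal (G := {x | x ∈ pathGradExp}) (by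
    intro g hg
    -- The generators are squarefree, so the derivatives have coefficient `1` in every
    -- characteristic.
    have h : ∀ g ∈ pathGradExp, ∃ a ∈ pathExp, ∃ i, a i = 1 ∧
      ∀ j, a j - (if j = i then 1 else 0) ≤ g j := by decide
    obtain ⟨a, ha, i, hi, hag⟩ := h g hg
    exact ⟨a, ha, i, by simp [hi], hag⟩)
  have h3 := gradient_le_gradientStar (listIdeal K pathExp)
  exact ⟨le_antisymm (h3.trans h1) h2, le_antisymm h3 (h1.trans h2)⟩

theorem regLE_pathGradExp : RegLE (listIdeal K pathGradExp) 3 := by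
  -- The last generator `x_5 x_6` breaks linear quotients: its colon ideal is `(x_1 x_2, x_3, x_4)`,
  -- of regularity at most `2`, and `2 + 2 = 3 + 1`.
  have hB : RegLE (listIdeal K
      [![1, 1, 0, 0, 0, 0], ![0, 0, 0, 1, 0, 0], (![0, 0, 1, 0, 0, 0] : Fin 6 → ℕ)]) 2 := by
    refine RegLE.cons (RegLE.cons (RegLE.cons (regLE_listIdeal_nil _) [] ?_ ?_ ?_)
      [2] ?_ ?_ ?_) [2, 3] ?_ ?_ ?_
    all_goals decide
  have hA : RegLE (listIdeal K pathGradExp.tail) 3 := by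
    refine RegLE.cons (RegLE.cons (RegLE.cons (RegLE.cons (RegLE.cons (RegLE.cons (RegLE.cons
      (RegLE.cons (regLE_listIdeal_nil _) [] ?_ ?_ ?_) [1] ?_ ?_ ?_) [0] ?_ ?_ ?_) [0, 2] ?_ ?_ ?_)
      [0, 1] ?_ ?_ ?_) [0, 1, 3] ?_ ?_ ?_) [1, 2] ?_ ?_ ?_) [1, 2, 4] ?_ ?_ ?_
    all_goals decide
  rw [listIdeal, pathGradExp, setOf_mem_cons]
  refine RegLE.insert_generator hA hB (by decide) (by decide) ?_ ?_
  · simp only [Pi.le_def, Pi.sub_apply, Set.mem_ofPred_eq]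
    decide
  · simp only [Pi.le_def, Pi.add_apply, Set.mem_ofPred_eq]
    decide

/-- `x^e` can occur in `x_k f` only if `x_k` divides it and `x^e / x_k` lies in the ideal, a
condition `decide` can refute. -/
theorem coeff_koszul_term_eq_zero {l : List (Fin n → ℕ)} {e : Fin n → ℕ} {k : Fin n} {m : ℕ}
    {f : MvPolynomial (Fin n) K} (hf : f ∈ listIdeal K l)
    (h : e k = 0 ∨ ∀ x ∈ l, ¬ ∀ i, x i ≤ e i - if i = k then 1 else 0) :
    coeff (Finsupp.equivFunOnFinite.symm e) ((-1) ^ m * X k * f) = 0 := by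
  by_contra hne
  obtain ⟨hk, hc⟩ := exists_coeff_ne_zero_of_coeff_X_mul hne
  rcases h with h | h
  · exact hk h
  · obtain ⟨x, hx, hxe⟩ := mem_monIdeal.1 hf _ (mem_support_iff.2 hc)
    refine h x hx fun i => (hxe i).trans (le_of_eq ?_)
    rw [Finsupp.tsub_apply, Finsupp.single_apply]
    simp only [eq_comm]
    rfl

/-- The syzygy of the two disjoint edges `x_1 x_2` and `x_5 x_6` gives a nonzero class
in `Tor_1`. -/
theorem not_koszulCycles_le_listIdeal_pathGradExp :
    ¬ koszulCycles (listIdeal K pathGradExp) 1 (1 + 3) ≤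
      koszulBoundaries (listIdeal K pathGradExp) 1 (1 + 3) := by
  intro hle
  let e₀ : Fin 6 → ℕ := ![0, 1, 0, 0, 1, 1]
  let e₁ : Fin 6 → ℕ := ![1, 0, 0, 0, 1, 1]
  let e₄ : Fin 6 → ℕ := ![1, 1, 0, 0, 0, 1]
  -- Both terms have multidegree `x_1 x_2 x_5 x_6`, where their differentials cancel.
  let z : Finset (Fin 6) → MvPolynomial (Fin 6) K :=
    Pi.single {0} (mon K e₀) - Pi.single {4} (mon K e₄)
  have hsingle : ∀ (k : Fin 6) (e : Fin 6 → ℕ), ∑ i, e i = 3 →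
      (∃ x ∈ pathGradExp, ∀ i, x i ≤ e i) →
      Pi.single {k} (mon K e) ∈ koszulChains (listIdeal K pathGradExp) 1 (1 + 3) := by
    intro k e he hx
    refine (mem_koszulChains (by omega)).2 fun T => ?_
    rcases eq_or_ne T {k} with rfl | hT
    · rw [Pi.single_eq_same]
      refine ⟨(monomial_mem_monIdeal one_ne_zero).2 hx, ?_, fun h => absurd (by simp) h⟩
      have := isHomogeneous_mon (K := K) e
      rwa [he] at this
    · rw [Pi.single_eq_of_ne hT]
      exact ⟨zero_mem _, isHomogeneous_zero _ _ _, fun _ => rfl⟩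
  have hz : z ∈ koszulChains (listIdeal K pathGradExp) 1 (1 + 3) :=
    Submodule.sub_mem _ (hsingle 0 e₀ (by decide) (by decide)) (hsingle 4 e₄ (by decide) (by decide))
  have hdz : koszulD 6 K z = 0 := by
    funext T
    rw [koszulD_apply]
    by_cases hT : T = ∅
    · subst hT
      have hX : X 0 * mon K e₀ = X 4 * mon K e₄ := by
        rw [X, X, monomial_mul, monomial_mul]
        congr 2
        ext i
        fin_cases i <;> simp [e₀, e₄]
      have h40 : ({4} : Finset (Fin 6)) ≠ {0} := by decide
      rw [Finset.sum_eq_add (0 : Fin 6) 4 (by decide)]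
      · simp [z, h40, h40.symm, Pi.single_eq_of_ne, hX]
      · intro k _ hk
        have h0 : ({k} : Finset (Fin 6)) ≠ {0} := by simpa using hk.1
        have h4 : ({k} : Finset (Fin 6)) ≠ {4} := by simpa using hk.2
        simp [z, h0, h4]
      · simp
      · simp
    · refine Finset.sum_eq_zero fun k hk => ?_
      rw [eq_zero_of_mem_koszulChains hz, mul_zero]
      rw [Finset.card_insert_of_notMem (by simpa using hk)]
      have := Finset.card_pos.2 (Finset.nonempty_iff_ne_empty.2 hT)
      omega
  obtain ⟨g, hg, hgz⟩ := hle ⟨hz, hdz⟩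
  have hgI := mem_of_mem_koszulChains hg
  -- If `z = dg`, let `c` be the coefficient of `x_5 x_6` in `g {0, 1}`. It alone determines the
  -- coefficients of `x_2 x_5 x_6` at `{0}` and of `x_1 x_5 x_6` at `{1}`, giving `1 = -c` and `0 =
  -- c`.
  have h0 : coeff (Finsupp.equivFunOnFinite.symm e₀) (koszulD 6 K g {0}) =
      -coeff (Finsupp.equivFunOnFinite.symm ![0, 0, 0, 0, 1, 1]) (g {0, 1}) := by
    rw [koszulD_apply, coeff_sum, Finset.sum_eq_single_of_mem 1 (by decide)]
    · have hc : (({0} : Finset (Fin 6)).filter (· < 1)).card = 1 := by decide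
      have he : Finsupp.equivFunOnFinite.symm e₀ =
          Finsupp.single 1 1 + Finsupp.equivFunOnFinite.symm ![0, 0, 0, 0, 1, 1] := by
        ext i
        fin_cases i <;> simp [e₀]
      rw [hc, pow_one, neg_one_mul, neg_mul, coeff_neg, he, coeff_X_mul, Finset.pair_comm]
    · intro k hk hk1
      refine coeff_koszul_term_eq_zero (hgI _) ?_
      revert k
      decide
  have h1 : coeff (Finsupp.equivFunOnFinite.symm e₁) (koszulD 6 K g {1}) =
      coeff (Finsupp.equivFunOnFinite.symm ![0, 0, 0, 0, 1, 1]) (g {0, 1}) := by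
    rw [koszulD_apply, coeff_sum, Finset.sum_eq_single_of_mem 0 (by decide)]
    · have hc : (({1} : Finset (Fin 6)).filter (· < 0)).card = 0 := by decide
      have he : Finsupp.equivFunOnFinite.symm e₁ =
          Finsupp.single 0 1 + Finsupp.equivFunOnFinite.symm ![0, 0, 0, 0, 1, 1] := by
        ext i
        fin_cases i <;> simp [e₁]
      rw [hc, pow_zero, one_mul, he, coeff_X_mul]
    · intro k hk hk1
      refine coeff_koszul_term_eq_zero (hgI _) ?_
      revert k
      decide
  have hz0 : z {0} = mon K e₀ := by simp [z]
  have hz1 : z {1} = 0 := by simp [z]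
  rw [hgz, hz0, mon, coeff_monomial, if_pos rfl] at h0
  rw [hgz, hz1, coeff_zero] at h1
  rw [← h1, neg_zero] at h0
  exact one_ne_zero h0

theorem hasRegularity_listIdeal_pathGradExp : HasRegularity (listIdeal K pathGradExp) 3 :=
  hasRegularity_of_regLE regLE_pathGradExp not_koszulCycles_le_listIdeal_pathGradExp

/-! ### The plane ideals -/

/-- The exponent vectors of the first `k` generators `x^c, x^(c-1) y, …`. -/
def planeExpInit (c k : ℕ) : Set (Fin 2 → ℕ) := {x | ∃ i < k, x = ![c - i, i]}

/-- The exponent vectors of the generators of `planeIdeal`. -/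
def planeExp (b c : ℕ) : Set (Fin 2 → ℕ) := insert ![0, b] (planeExpInit c c)

theorem planeIdeal_eq_monIdeal (b c : ℕ) : planeIdeal K b c = monIdeal K (planeExp b c) := by
  rw [planeIdeal, monIdeal, planeExp, Set.image_insert_eq, Set.union_singleton]
  congr 2
  · simp [mon_eq_prod]
  · ext p
    constructor
    · rintro ⟨i, hi, rfl⟩
      exact ⟨_, ⟨i, hi, rfl⟩, by simp [mon_eq_prod]⟩
    · rintro ⟨_, ⟨i, hi, rfl⟩, rfl⟩
      exact ⟨i, hi, by simp [mon_eq_prod]⟩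

theorem planeExp_minimal {b c : ℕ} (hbc : c ≤ b) :
    ∀ x ∈ planeExp b c, ∀ y ∈ planeExp b c, y ≤ x → y = x := by
  rintro x (rfl | ⟨i, hi, rfl⟩) y (rfl | ⟨j, hj, rfl⟩) h
  · rfl
  all_goals
    have h0 := h 0
    have h1 := h 1
    simp at h0 h1
  · omega
  · omega
  · rw [show j = i by omega]

theorem regLE_planeExpInit (c : ℕ) {k : ℕ} (hk : k ≤ c) :
    RegLE (monIdeal K (planeExpInit c k)) c := by
  induction k with
  | zero =>
    have : planeExpInit c 0 = ∅ := by
      ext x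
      simp [planeExpInit]
    rw [this, monIdeal_empty]
    exact regLE_bot c
  | succ k ih =>
    have : planeExpInit c (k + 1) = insert ![c - k, k] (planeExpInit c k) := by
      ext x
      constructor
      · rintro ⟨i, hi, rfl⟩
        rcases Nat.lt_succ_iff_lt_or_eq.1 hi with h | rfl
        · exact Or.inr ⟨i, h, rfl⟩
        · exact Or.inl rfl
      · rintro (rfl | ⟨i, hi, rfl⟩)
        · exact ⟨k, by omega, rfl⟩
        · exact ⟨i, by omega, rfl⟩
    rw [this]
    -- The colon ideal by `x^(c-k) y^k` is `(x)`, except for the first generator, where it is zero.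
    refine (ih (by omega)).insert_of_varColon {v | v = 0 ∧ 0 < k} ?_ ?_ ?_
    · simp
      omega
    · rintro _ ⟨i, hi, rfl⟩
      refine ⟨0, ⟨rfl, by omega⟩, ?_⟩
      simp
      omega
    · rintro _ ⟨rfl, hk0⟩
      refine ⟨_, ⟨k - 1, by omega, rfl⟩, ?_⟩
      simp [Fin.forall_fin_succ]
      omega

/-- Adding `y^b` has colon ideal `(x)`, because `x y^(c-1)` divides `x y^b`. The case `b = c` is the
power `(x, y)^c`, which is reused for the gradient. -/
theorem hasRegularity_planeExp {b c : ℕ} (hc : 1 ≤ c) (hbc : c ≤ b) :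
    HasRegularity (monIdeal K (planeExp b c)) b := by
  have h : RegLE (monIdeal K (planeExp b c)) b := by
    refine ((regLE_planeExpInit c le_rfl).mono hbc).insert_of_varColon {0} (by simp) ?_ ?_
    · rintro _ ⟨i, hi, rfl⟩
      exact ⟨0, rfl, by simpa using hi⟩
    · rintro _ rfl
      refine ⟨_, ⟨c - 1, by omega, rfl⟩, ?_⟩
      simp [Fin.forall_fin_succ]
      omega
  have ha : ![0, b] ∈ planeExp b c := Or.inl rfl
  exact hasRegularity_of_regLE h
    (not_koszulCycles_le_of_minimal ha (planeExp_minimal hbc _ ha) (by simp))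

/-- The right side is `(x, y)^(c-1)`. Lowering the exponent of `x` in the `x^(c-i) y^i` already
produces all its generators, and `y^(b-1)` adds nothing as `c ≤ b`. -/
theorem gradientStar_planeIdeal {b c : ℕ} (hc : 2 ≤ c) (hbc : c ≤ b) :
    gradientStar (planeIdeal K b c) = monIdeal K (planeExp (c - 1) (c - 1)) := by
  rw [planeIdeal_eq_monIdeal]
  refine le_antisymm (gradientStar_monIdeal_le (planeExp_minimal hbc) ?_)
    (monIdeal_le_gradientStar (planeExp_minimal hbc) ?_)
  · rintro _ (rfl | ⟨i, hi, rfl⟩) k hk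
    · obtain rfl | rfl : k = 0 ∨ k = 1 := by omega
      · simp at hk
      · exact ⟨_, Or.inl rfl, by simp [Fin.forall_fin_succ]; omega⟩
    · obtain rfl | rfl : k = 0 ∨ k = 1 := by omega
      · rcases Nat.lt_or_ge i (c - 1) with h | h
        · exact ⟨_, Or.inr ⟨i, h, rfl⟩, by simp [Fin.forall_fin_succ]; omega⟩
        · exact ⟨_, Or.inl rfl, by simp [Fin.forall_fin_succ]; omega⟩
      · simp at hk
        exact ⟨_, Or.inr ⟨i - 1, by omega, rfl⟩, by simp [Fin.forall_fin_succ]; omega⟩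
  · rintro _ (rfl | ⟨i, hi, rfl⟩)
    · exact ⟨_, Or.inr ⟨c - 1, by omega, rfl⟩, 0, by simp; omega,
        by simp [Fin.forall_fin_succ]; omega⟩
    · exact ⟨_, Or.inr ⟨i, by omega, rfl⟩, 0, by simp; omega,
        by simp [Fin.forall_fin_succ]; omega⟩

theorem gradient_planeIdeal_of_monIdeal_le {b c : ℕ} (hc : 2 ≤ c) (hbc : c ≤ b)
    (h : monIdeal K (planeExp (c - 1) (c - 1)) ≤ gradient (planeIdeal K b c)) :
    gradient (planeIdeal K b c) = gradientStar (planeIdeal K b c) :=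
  le_antisymm (gradient_le_gradientStar _) ((gradientStar_planeIdeal hc hbc).trans_le h)

/-- The `x`-derivatives of the `x^(c-i) y^i` give `(x, y)^(c-1)`; their coefficients `c - i` are
positive and at most `b`, hence invertible. -/
theorem gradient_planeIdeal_of_ringChar {b c : ℕ} (hc : 2 ≤ c) (hbc : c ≤ b)
    (hK : ringChar K = 0 ∨ b < ringChar K) :
    gradient (planeIdeal K b c) = gradientStar (planeIdeal K b c) := by
  have hne : ∀ m : ℕ, 0 < m → m ≤ b → (m : K) ≠ 0 := by
    intro m hm hmb h
    have hdvd := (ringChar.spec K m).1 h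
    rcases hK with hK | hK
    · rw [hK, zero_dvd_iff] at hdvd
      omega
    · have := Nat.le_of_dvd hm hdvd
      omega
  refine gradient_planeIdeal_of_monIdeal_le hc hbc ?_
  rw [planeIdeal_eq_monIdeal]
  refine monIdeal_le_gradient (planeExp_minimal hbc) ?_
  rintro _ (rfl | ⟨i, hi, rfl⟩)
  · exact ⟨_, Or.inr ⟨c - 1, by omega, rfl⟩, 0, hne _ (by simp; omega) (by simp; omega),
      by simp [Fin.forall_fin_succ]; omega⟩
  · exact ⟨_, Or.inr ⟨i, by omega, rfl⟩, 0, hne _ (by simp; omega) (by simp; omega),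
      by simp [Fin.forall_fin_succ]; omega⟩

/-- For `c = 2` the gradient ideal is `(x, y)` in every characteristic. -/
theorem gradient_planeIdeal_two {b : ℕ} (hb : 2 ≤ b) :
    gradient (planeIdeal K b 2) = gradientStar (planeIdeal K b 2) := by
  refine gradient_planeIdeal_of_monIdeal_le le_rfl hb ?_
  rw [planeIdeal_eq_monIdeal]
  refine monIdeal_le_gradient (planeExp_minimal hb) ?_
  -- Both partial derivatives of `xy` have coefficient `1`.
  have h11 : ![1, 1] ∈ planeExp b 2 := Or.inr ⟨1, one_lt_two, rfl⟩
  rintro _ (rfl | ⟨i, hi, rfl⟩)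
  · exact ⟨_, h11, 0, by simp, by simp [Fin.forall_fin_succ]⟩
  · obtain rfl : i = 0 := by omega
    exact ⟨_, h11, 1, by simp, by simp [Fin.forall_fin_succ]⟩

theorem regDiffEq_planeIdeal {a : ℤ} {b c : ℕ} (hc : 2 ≤ c) (hbc : c ≤ b)
    (ha : (b : ℤ) - (c : ℤ) + 1 = a)
    (h : gradient (planeIdeal K b c) = gradientStar (planeIdeal K b c)) :
    RegDiffEq (planeIdeal K b c) a := by
  refine ⟨b, (c - 1 : ℕ), ?_, ?_, by omega⟩
  · rw [planeIdeal_eq_monIdeal]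
    exact hasRegularity_planeExp (by omega) hbc
  · rw [h, gradientStar_planeIdeal hc hbc]
    exact hasRegularity_planeExp (by omega) le_rfl

/-! ### Regularity differences and monomiality of the explicit ideals -/

theorem regDiffEq_pathIdeal : RegDiffEq (pathIdeal K) 0 := by
  refine ⟨3, 3, hasRegularity_pathIdeal, ?_, by norm_num⟩
  rw [gradient_pathIdeal.1]
  exact hasRegularity_listIdeal_pathGradExp

theorem regDiffEq_negIdeal {a : ℤ} {b : ℕ} (hb : 2 ≤ b) (ha : (b : ℤ) = 2 - a) :
    RegDiffEq (negIdeal K b) a := by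
  refine ⟨b + 1, (2 * b - 1 : ℕ), hasRegularity_negIdeal hb, ?_, by omega⟩
  rw [(gradient_negIdeal hb).1]
  exact hasRegularity_monIdeal_negGradExp hb

theorem isMonomialIdeal_negIdeal (b : ℕ) : IsMonomialIdeal (negIdeal K b) :=
  negIdeal_eq_monIdeal (K := K) b ▸ isMonomialIdeal_monIdeal _

theorem isMonomialIdeal_pathIdeal : IsMonomialIdeal (pathIdeal K) :=
  pathIdeal_eq_listIdeal (K := K) ▸ isMonomialIdeal_monIdeal _

theorem isMonomialIdeal_planeIdeal (b c : ℕ) : IsMonomialIdeal (planeIdeal K b c) :=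
  planeIdeal_eq_monIdeal (K := K) b c ▸ isMonomialIdeal_monIdeal _

end MonGrad

end

open MonGrad in
theorem theorem2p2 (K : Type*) [Field K] :
    -- every integer is attained
    (∀ a : ℤ, ∃ n : ℕ, 0 < n ∧ ∃ I : Ideal (MvPolynomial (Fin n) K),
      IsMonomialIdeal I ∧ gradient I = gradientStar I ∧ RegDiffEq I a) ∧
    -- the explicit ideals for negative integers
    (∀ a : ℤ, a ≤ -1 → ∀ b : ℕ, (b : ℤ) = 2 - a →
      IsMonomialIdeal (negIdeal K b) ∧ HasLinearQuotients (negIdeal K b) ∧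
      gradient (negIdeal K b) = gradientStar (negIdeal K b) ∧
      IsCompleteIntersection (gradient (negIdeal K b)) ∧ RegDiffEq (negIdeal K b) a) ∧
    -- the explicit ideal for zero
    (IsMonomialIdeal (pathIdeal K) ∧ gradient (pathIdeal K) = gradientStar (pathIdeal K) ∧
      RegDiffEq (pathIdeal K) 0) ∧
    -- the explicit ideals for positive integers
    (∀ a : ℤ, 1 ≤ a → ∀ b c : ℕ, 2 ≤ b → 2 ≤ c → (b : ℤ) - (c : ℤ) + 1 = a →
      IsMonomialIdeal (planeIdeal K b c) ∧
      (ringChar K = 0 ∨ b < ringChar K →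
        gradient (planeIdeal K b c) = gradientStar (planeIdeal K b c)) ∧
      (gradient (planeIdeal K b c) = gradientStar (planeIdeal K b c) →
        RegDiffEq (planeIdeal K b c) a)) := by
  have hneg : ∀ a : ℤ, a ≤ -1 → ∀ b : ℕ, (b : ℤ) = 2 - a →
      IsMonomialIdeal (negIdeal K b) ∧ HasLinearQuotients (negIdeal K b) ∧
      gradient (negIdeal K b) = gradientStar (negIdeal K b) ∧
      IsCompleteIntersection (gradient (negIdeal K b)) ∧ RegDiffEq (negIdeal K b) a := by
    intro a ha b hba
    have hb : 2 ≤ b := by omega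
    refine ⟨isMonomialIdeal_negIdeal b, hasLinearQuotients_negIdeal hb, (gradient_negIdeal hb).2, ?_,
      regDiffEq_negIdeal hb hba⟩
    rw [(gradient_negIdeal hb).1]
    exact isCompleteIntersection_monIdeal_negGradExp hb
  refine ⟨fun a => ?_, hneg, ⟨isMonomialIdeal_pathIdeal, gradient_pathIdeal.2,
    regDiffEq_pathIdeal⟩, ?_⟩
  · rcases lt_trichotomy a 0 with ha | rfl | ha
    · obtain ⟨h1, _, h2, _, h3⟩ := hneg a (by omega) (2 - a).toNat (by omega)
      exact ⟨4, by norm_num, _, h1, h2, h3⟩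
    · exact ⟨6, by norm_num, _, isMonomialIdeal_pathIdeal, gradient_pathIdeal.2,
        regDiffEq_pathIdeal⟩
    -- The choice `c = 2`, `b = a + 1` avoids any restriction on the characteristic.
    · have hb : 2 ≤ (a + 1).toNat := by omega
      have h := gradient_planeIdeal_two (K := K) hb
      exact ⟨2, by norm_num, _, isMonomialIdeal_planeIdeal _ 2, h,
        regDiffEq_planeIdeal le_rfl hb (by omega) h⟩
  · intro a ha b c _ hc hbc
    exact ⟨isMonomialIdeal_planeIdeal b c,
      gradient_planeIdeal_of_ringChar hc (by omega),
      regDiffEq_planeIdeal hc (by omega) hbc⟩
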